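/- **Theorem 3.1 ($k^{th}$-order Euler-Poincaré reduction).** Let $G$ be a finite-dimensional real Lie group with Lie algebra $\mathfrak g$ (with the bracket of left-invariant vector fields), let $k\ge 1$, and let $T^{(k)}G$ be the $k^{th}$-order tangent bundle, whose points are the classes $[c]^{(k)}$ of curves $c$ in $G$ of class $C^k$ near $0$, two curves being identified if they have the same point and, in every chart, the same derivatives of orders $1,\dots,k$ at time $0$. Let $L:T^{(k)}G\to\mathbb R$ be a smooth Lagrangian that is invariant under the lift to $T^{(k)}G$ of right (resp. left) translations of $G$. For a curve $c$ in $G$ put $\xi_c=\dot c\,c^{-1}$ (resp. $\xi_c=c^{-1}\dot c$), and let $\ell:k\mathfrak g=\mathfrak g^{\oplus k}\to\mathbb R$ be the reduced Lagrangian, i.e. the function determined by $\ell\big(\xi_c(0),\dot\xi_c(0),\dots,\xi_c^{(k-1)}(0)\big)=L([c]^{(k)})$. Let $t_0<t_1$, let $g$ be a curve in $G$ that is smooth on an open neighbourhood of $[t_0,t_1]$, and let $\xi=\xi_g$. Write $\mathrm{ad}^*_\xi$ for the transpose of $\mathrm{ad}_\xi=[\xi,\cdot\,]$; upper signs refer to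 right and lower signs to left invariance. All variations and the curves $\eta$ below are smooth near $[t_0,t_1]$ (and for $\varepsilon$ near $0$), and $\delta=\frac{\partial}{\partial\varepsilon}\big|_{\varepsilon=0}$. Then the following are equivalent. (i) $g$ solves the $k^{th}$-order Euler–Lagrange equations on $[t_0,t_1]$: in the natural coordinates $(q,\dot q,\dots,q^{(k)})$ induced by any chart, $\sum_{j=0}^{k}(-1)^j\frac{d^j}{dt^j}\frac{\partial L}{\partial q^{(j)}}=0$ along $g$. (ii) Hamilton's principle $\delta\int_{t_0}^{t_1}L(g,\dot g,\dots,g^{(k)})\,dt=0$ holds for all variations of $g$ such that $\delta g^{(j)}$ (computed in charts) vanishes at $t_0$ and $t_1$ for $j=0,\dots,k-1$. (iii) The $k^{th}$-order Euler–Poincaré equations hold on $[t_0,t_1]$: $$\Big(\frac{d}{dt}\pm\mathrm{ad}^*_\xi\Big)\sum_{j=0}^{k-1}(-1)^j\frac{d^j}{dt^j}\frac{\delta\ell}{\delta\xi^{(j)}}=0 .$$ (iv) The reduced principle $\delta\int_{t_0}^{t_1}\ell(\xi,\dot\xi,\dots,\xi^{(k-1)})\,dt=0$ holds for all variations of $\xi$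 of the form $\delta\xi=\dot\eta\mp[\xi,\eta]$ on $[t_0,t_1]$, where $\eta$ is an arbitrary curve in $\mathfrak g$ such that $\eta^{(j)}$ vanishes at $t_0$ and $t_1$ for $j=0,\dots,k-1$. -/

import Mathlib

open Set Filter Topology MeasureTheory
open scoped Manifold ContDiff

noncomputable section

namespace HigherOrderEP

section Jets

variable {E : Type*} [NormedAddCommGroup E] [NormedSpace ℝ E]
variable (E) in
/-- The smooth charts of a manifold `M` modelled on `E`. -/
def smoothCharts (M : Type*) [TopologicalSpace M] [ChartedSpace E M] :
    Set (OpenPartialHomeomorph M E) :=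
  IsManifold.maximalAtlas 𝓘(ℝ, E) ∞ M

/-- `f` is smooth on some open neighbourhood of the set `s`. -/
def SmoothNear {F : Type*} [NormedAddCommGroup F] [NormedSpace ℝ F]
    {M : Type*} [TopologicalSpace M] [ChartedSpace E M] (f : F → M) (s : Set F) : Prop :=
  ∃ U : Set F, IsOpen U ∧ s ⊆ U ∧ ContMDiffOn 𝓘(ℝ, F) 𝓘(ℝ, E) ∞ f U

variable (E) in
/-- Curves in `M` that are of class `C^k` around time `0`. -/
def JetCurve (k : ℕ) (M : Type*) [TopologicalSpace M] [ChartedSpace E M] : Type _ :=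
  {c : ℝ → M // ContMDiffAt 𝓘(ℝ, ℝ) 𝓘(ℝ, E) (k : ℕ∞) c 0}

variable (E) in
/-- Two curves are identified if they have the same base point at time `0` and, in every chart
around it, the same derivatives of order `1, …, k` at time `0`. -/
def jetSetoid (k : ℕ) (M : Type*) [TopologicalSpace M] [ChartedSpace E M] :
    Setoid (JetCurve E k M) where
  r c₁ c₂ := c₁.1 0 = c₂.1 0 ∧ ∀ e ∈ smoothCharts E M, c₁.1 0 ∈ e.source →
    ∀ l : ℕ, 1 ≤ l → l ≤ k →
      iteratedDeriv l (fun s => e (c₁.1 s)) 0 = iteratedDeriv l (fun s => e (c₂.1 s)) 0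
  iseqv :=
    { refl := fun _ => ⟨rfl, fun _ _ _ _ _ _ => rfl⟩
      symm := fun h => ⟨h.1.symm, fun e he hs l h1 h2 => (h.2 e he (h.1 ▸ hs) l h1 h2).symm⟩
      trans := fun h h' => ⟨h.1.trans h'.1, fun e he hs l h1 h2 =>
        (h.2 e he hs l h1 h2).trans (h'.2 e he (h.1 ▸ hs) l h1 h2)⟩ }

variable (E) in
/-- The `k`-th order tangent bundle `T^(k) M`: equivalence classes of `C^k` curves. -/
def HigherTangent (k : ℕ) (M : Type*) [TopologicalSpace M] [ChartedSpace E M] : Type _ :=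
  Quotient (jetSetoid E k M)

variable {M : Type*} [TopologicalSpace M] [ChartedSpace E M] {k : ℕ}

/-- The class `[c]^(k)` of a curve in `T^(k) M`. -/
def jetMk (c : JetCurve E k M) : HigherTangent E k M :=
  Quotient.mk (jetSetoid E k M) c

open Classical in
/-- `L(c(t), ċ(t), …, c^(k)(t))`, the value of `L` on the `k`-jet of the curve `c` at time `t`.
The value `0` is only a convention at times around which `c` is not of class `C^k`. -/
def lagrangianAlong (L : HigherTangent E k M → ℝ) (c : ℝ → M) (t : ℝ) : ℝ :=
  if h : ContMDiffAt 𝓘(ℝ, ℝ) 𝓘(ℝ, E) (k : ℕ∞) (fun s => c (t + s)) 0 then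
    L (jetMk ⟨fun s => c (t + s), h⟩)
  else 0

/-- The expression of `L` in the natural coordinates `(q, q̇, …, q^(k))` of `T^(k) M` induced by
the chart `e`: these are the coordinates of the jet at time `0` of the curve whose expression in
the chart is `s ↦ ∑ j, s ^ j / j! • q j`. It is meaningful where `q 0 ∈ e.target`. -/
def localLagrangian (L : HigherTangent E k M → ℝ) (e : OpenPartialHomeomorph M E)
    (q : Fin (k + 1) → E) : ℝ :=
  lagrangianAlong L
    (fun s => e.symm (∑ j : Fin (k + 1), (s ^ (j : ℕ) / (Nat.factorial j : ℝ)) • q j)) 0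

/-- `L` is a smooth function on `T^(k) M`: it is smooth in all natural coordinate systems. -/
def IsSmoothLagrangian (L : HigherTangent E k M → ℝ) : Prop :=
  ∀ e ∈ smoothCharts E M,
    ContDiffOn ℝ ∞ (localLagrangian L e) {q : Fin (k + 1) → E | q 0 ∈ e.target}

/-- The partial derivative `∂f/∂x_j` of a function of `n` vector variables, as a covector. -/
def partialD {n : ℕ} (f : (Fin n → E) → ℝ) (j : Fin n) (x : Fin n → E) : E →L[ℝ] ℝ :=
  (fderiv ℝ f x).comp (ContinuousLinearMap.single ℝ (fun _ : Fin n => E) j)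

/-- The tuple `(x(t), ẋ(t), …, x^(n-1)(t))`. -/
def derivTuple (n : ℕ) (x : ℝ → E) (t : ℝ) : Fin n → E :=
  fun i => iteratedDeriv i x t

/-- The curve of covectors `∑_{j<n} (-1)^j (d/dt)^j (∂f/∂x^(j))(x, ẋ, …, x^(n-1))`. -/
def eulerOperator {n : ℕ} (f : (Fin n → E) → ℝ) (x : ℝ → E) (t : ℝ) : E →L[ℝ] ℝ :=
  ∑ j : Fin n, (-1 : ℝ) ^ (j : ℕ) •
    iteratedDeriv j (fun s => partialD f j (derivTuple n x s)) t

/-- The `k`-th order Euler-Lagrange equations on `[t₀, t₁]`, in every chart that the curve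
meets. -/
def EulerLagrange (L : HigherTangent E k M → ℝ) (g : ℝ → M) (t₀ t₁ : ℝ) : Prop :=
  ∀ t ∈ Icc t₀ t₁, ∀ e ∈ smoothCharts E M, g t ∈ e.source →
    eulerOperator (localLagrangian L e) (fun s => e (g s)) t = 0

variable (E) in
/-- `γ ε t` is a smooth variation of the curve `g` on `[t₀, t₁]`, defined for small `ε`. -/
def IsVariation (g : ℝ → M) (t₀ t₁ : ℝ) (γ : ℝ → ℝ → M) : Prop :=
  SmoothNear (E := E) (fun p : ℝ × ℝ => γ p.1 p.2) ({0} ×ˢ Icc t₀ t₁) ∧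
    ∀ t ∈ Icc t₀ t₁, γ 0 t = g t

variable (E) in
/-- `δg^(j)(τ) = 0` for `j = 0, …, k-1`, where `δg = ∂γ/∂ε` at `ε = 0`; the derivatives are taken
in the charts around `γ 0 τ`. -/
def VariationVanishesAt (k : ℕ) (γ : ℝ → ℝ → M) (τ : ℝ) : Prop :=
  ∀ e ∈ smoothCharts E M, γ 0 τ ∈ e.source →
    ∀ j < k, iteratedDeriv j (fun t => deriv (fun ε => e (γ ε t)) 0) τ = 0

/-- Hamilton's principle `δ ∫ L(g, ġ, …, g^(k)) dt = 0` for all variations such that `δg^(j)`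
vanishes at the endpoints for `j = 0, …, k-1`. -/
def HamiltonPrinciple (L : HigherTangent E k M → ℝ) (g : ℝ → M) (t₀ t₁ : ℝ) : Prop :=
  ∀ γ : ℝ → ℝ → M, IsVariation E g t₀ t₁ γ →
    VariationVanishesAt E k γ t₀ → VariationVanishesAt E k γ t₁ →
      HasDerivAt (fun ε => ∫ t in t₀..t₁, lagrangianAlong L (γ ε) t) 0 0

end Jets

/-- The side on which the group acts on itself by translations. -/
inductive Side where
  | right
  | left

/-- The upper sign `+` is for right invariance, the lower sign `-` for left invariance. -/
def Side.sign : Side → ℝ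
  | .right => 1
  | .left => -1

section Group

variable {E : Type*} [NormedAddCommGroup E] [NormedSpace ℝ E]
variable {G : Type*} [TopologicalSpace G] [ChartedSpace E G] [Group G]

/-- Right (resp. left) translation by `h`. -/
def Side.translate : Side → G → G → G
  | .right, h, x => x * h
  | .left, h, x => h * x

theorem Side.contMDiff_translate [LieGroup 𝓘(ℝ, E) ∞ G] (S : Side) (h : G) :
    ContMDiff 𝓘(ℝ, E) 𝓘(ℝ, E) ∞ (S.translate h) := by
  cases S
  · exact contMDiff_mul_right
  · exact contMDiff_mul_left

/-- The action of `h` on curves by right (resp. left) translation. -/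
def JetCurve.translate [LieGroup 𝓘(ℝ, E) ∞ G] {k : ℕ} (S : Side) (h : G) (c : JetCurve E k G) :
    JetCurve E k G :=
  ⟨fun s => S.translate h (c.1 s),
    (((S.contMDiff_translate (E := E) h).of_le (by exact_mod_cast le_top)).contMDiffAt).comp 0 c.2⟩

/-- Invariance of `L` under the lift to `T^(k) G` of right (resp. left) translations. -/
def IsInvariantLagrangian [LieGroup 𝓘(ℝ, E) ∞ G] {k : ℕ} (S : Side)
    (L : HigherTangent E k G → ℝ) : Prop :=
  ∀ (h : G) (c : JetCurve E k G), L (jetMk (c.translate S h)) = L (jetMk c)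

/-! The Lie algebra of `G` is the tangent space at `1`, whose underlying vector space is the model
space `E`. -/

variable (E) in
/-- The reduced curve `ξ = ġ g⁻¹` (resp. `ξ = g⁻¹ ġ`) in the Lie algebra: the velocity of `g` at
time `t`, translated to the identity by the tangent map of the translation by `(g t)⁻¹`. -/
def reducedCurve (S : Side) (g : ℝ → G) (t : ℝ) : E :=
  mfderiv 𝓘(ℝ, E) 𝓘(ℝ, E) (S.translate (g t)⁻¹) (g t)
    (mfderiv 𝓘(ℝ, ℝ) 𝓘(ℝ, E) g t (1 : ℝ))

/-- The quotient map `(g, ġ, …, g^(k)) ↦ (ξ, …, ξ^(k-1))`, on curves representing jets. -/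
def quotientMap {k : ℕ} (S : Side) (c : JetCurve E k G) : Fin k → E :=
  derivTuple k (reducedCurve E S c.1) 0

/-- The reduced Lagrangian `ℓ : k𝔤 → ℝ` induced by the invariant Lagrangian `L` via the quotient
map `T^(k) G → (T^(k) G)/G = k𝔤`: the value at `ζ` is `L [c]` for any `c` whose class is sent
to `ζ`. -/
def reducedLagrangian {k : ℕ} (S : Side) (L : HigherTangent E k G → ℝ) : (Fin k → E) → ℝ :=
  Function.extend (quotientMap S) (fun c : JetCurve E k G => L (jetMk c)) 0

variable (G) in
/-- The Lie bracket of the Lie algebra of `G`. -/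
def bracket (x y : E) : E :=
  Bracket.bracket (L := GroupLieAlgebra 𝓘(ℝ, E) G) (M := GroupLieAlgebra 𝓘(ℝ, E) G) x y

variable (G) in
/-- The operator `ad_x y = [x, y]`. -/
def ad [FiniteDimensional ℝ E] [LieGroup 𝓘(ℝ, E) ∞ G] (x : E) : E →ₗ[ℝ] E :=
  haveI : CompleteSpace E := FiniteDimensional.complete ℝ E
  haveI : LieGroup 𝓘(ℝ, E) (minSmoothness ℝ 3) G :=
    LieGroup.of_le (n := ∞) (by
      rw [minSmoothness_of_isRCLikeNormedField]
      exact ENat.LEInfty.out)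
  { toFun := bracket G x
    map_add' := by
      intro y z
      exact lie_add (L := GroupLieAlgebra 𝓘(ℝ, E) G) (M := GroupLieAlgebra 𝓘(ℝ, E) G) x y z
    map_smul' := by
      intro a y
      exact lie_smul (R := ℝ) (L := GroupLieAlgebra 𝓘(ℝ, E) G)
        (M := GroupLieAlgebra 𝓘(ℝ, E) G) a x y }

variable (G) in
/-- The operator `ad*_x`, the transpose of `ad_x`: `⟨ad*_x μ, y⟩ = ⟨μ, [x, y]⟩`. -/
def adStar [FiniteDimensional ℝ E] [LieGroup 𝓘(ℝ, E) ∞ G] (x : E) (μ : E →L[ℝ] ℝ) :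
    E →L[ℝ] ℝ :=
  μ.comp (LinearMap.toContinuousLinearMap (ad G x))

variable (G) in
/-- The `k`-th order Euler-Poincaré equations
`(d/dt ± ad*_ξ) ∑_{j<k} (-1)^j (d/dt)^j (δℓ/δξ^(j)) = 0` on `[t₀, t₁]`. -/
def EulerPoincare [FiniteDimensional ℝ E] [LieGroup 𝓘(ℝ, E) ∞ G] {k : ℕ} (S : Side)
    (l : (Fin k → E) → ℝ) (ξ : ℝ → E) (t₀ t₁ : ℝ) : Prop :=
  ∀ t ∈ Icc t₀ t₁,
    deriv (eulerOperator l ξ) t + S.sign • adStar G (ξ t) (eulerOperator l ξ t) = 0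

variable (G) in
/-- The reduced principle `δ ∫ ℓ(ξ, ξ̇, …, ξ^(k-1)) dt = 0` for all variations `Ξ ε t` of `ξ` with
`δξ = η̇ ∓ [ξ, η]`, where `η^(j)` vanishes at the endpoints for `j = 0, …, k-1`. -/
def ReducedPrinciple {k : ℕ} (S : Side) (l : (Fin k → E) → ℝ) (ξ : ℝ → E) (t₀ t₁ : ℝ) : Prop :=
  ∀ η : ℝ → E, SmoothNear (E := E) η (Icc t₀ t₁) →
    (∀ j < k, iteratedDeriv j η t₀ = 0 ∧ iteratedDeriv j η t₁ = 0) →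
    ∀ Ξ : ℝ → ℝ → E, IsVariation E ξ t₀ t₁ Ξ →
      (∀ t ∈ Icc t₀ t₁,
        deriv (fun ε => Ξ ε t) 0 = deriv η t - S.sign • bracket G (ξ t) (η t)) →
      HasDerivAt (fun ε => ∫ t in t₀..t₁, l (derivTuple k (Ξ ε) t)) 0 0

end Group

end HigherOrderEP

end

/-! All conditions are compared with the Euler–Poincaré equations (iii), through first variation
formulas for the action.

For a family γ(ε,t) in G let X and Y be its reduced velocities in t and in ε. The Maurer–Cartan
equation says ∂X/∂ε = ∂Y/∂t ∓ [X,Y] (`deriv_reducedCurve`), so a variation of g with reduced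
variation η = Y produces exactly the variations of ξ allowed in (iv). Invariance turns L along a
curve into ℓ evaluated on the jet of its reduced velocity (`lagrangianAlong_eq_reducedLagrangian`).
Repeated integration by parts then gives, with P the left side of (iii), δ∫L = δ∫ℓ = -∫⟨P, η⟩
(`hasDerivAt_reducedAction`, `hasDerivAt_invariantAction`). If P = 0, both principles follow.
Conversely, every η supported inside the interval is realized, in (iv) by a variation of ξ affine in
ε and in (ii) by `groupVariation`, so P = 0 by the fundamental lemma of the calculus of variations.

For (i), the same computation in a chart gives δ∫L = ∫⟨Euler–Lagrange operator, δq⟩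
(`hasDerivAt_action_chart`). On an interval short enough for g to stay in one chart, this and the
reduced formula compute the same derivative, so if one operator vanishes, the fundamental lemma
kills the other. The endpoints are reached by continuity.

All this needs ℓ to be well defined and smooth. Once a curve is translated to pass through 1, its
expression u in the chart at 1 satisfies u' = B(u) ξ with B the invariant frame, so the (k-1)-jet of
ξ determines the k-jet of u; this gives well-definedness. Solving that equation formally, by
polynomials whose coefficients depend smoothly on the jet of ξ (`exists_formal_solution`), gives a
smooth section of the quotient map, and ℓ is a local expression of L composed with it
(`contDiff_reducedLagrangian`). No differential equation has to be solved exactly. -/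

noncomputable section

namespace HigherOrderEP

/-! ### Jets, differentiation under the integral, integration by parts and the fundamental lemma. -/

section Calculus

variable {E F X : Type*} [NormedAddCommGroup E] [NormedSpace ℝ E]
  [NormedAddCommGroup F] [NormedSpace ℝ F] [NormedAddCommGroup X] [NormedSpace ℝ X]

/-- The jet of `H ∘ u` at `t` only depends on `H` and on the jet of `u` at `t`. -/
theorem iteratedDeriv_comp_congr {H : E → F} {u v : ℝ → E} {t : ℝ} {m : ℕ}
    (hH : ContDiffAt ℝ m H (u t)) (hu : ContDiffAt ℝ m u t) (hv : ContDiffAt ℝ m v t)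
    (h : ∀ j ≤ m, iteratedDeriv j u t = iteratedDeriv j v t) :
    ∀ j ≤ m, iteratedDeriv j (fun s => H (u s)) t = iteratedDeriv j (fun s => H (v s)) t := by
  intro j hj
  have h0 : u t = v t := by simpa using h 0 (Nat.zero_le _)
  have hF : ∀ i ≤ m, iteratedFDeriv ℝ i u t = iteratedFDeriv ℝ i v t := by
    intro i hi
    rw [iteratedFDeriv_eq_equiv_comp, iteratedFDeriv_eq_equiv_comp, Function.comp_apply,
      Function.comp_apply, h i hi]
  have hj' : (j : WithTop ℕ∞) ≤ m := by exact_mod_cast hj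
  rw [iteratedDeriv_eq_iteratedFDeriv, iteratedDeriv_eq_iteratedFDeriv]
  -- Faà di Bruno: the `j`-th derivative of a composite is a sum over ordered partitions whose parts
  -- have size at most `j`, so only derivatives of the inner curve up to order `j` enter.
  have e1 := iteratedFDeriv_comp hH hu hj'
  have e2 := iteratedFDeriv_comp (h0 ▸ hH) hv hj'
  change iteratedFDeriv ℝ j (H ∘ u) t _ = iteratedFDeriv ℝ j (H ∘ v) t _
  rw [e1, e2, ← h0]
  congr 1
  unfold FormalMultilinearSeries.taylorComp
  refine Finset.sum_congr rfl fun c _ => ?_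
  ext
  simp only [FormalMultilinearSeries.compAlongOrderedFinpartition_apply]
  congr 1
  ext i
  simp only [OrderedFinpartition.applyOrderedFinpartition, ftaylorSeries]
  rw [hF _ ((c.partSize_le i).trans hj)]

theorem contDiffAt_iteratedDeriv {u : ℝ → E} {t : ℝ} (hu : ContDiffAt ℝ ∞ u t) (j : ℕ) :
    ContDiffAt ℝ ∞ (iteratedDeriv j u) t := by
  induction j generalizing u with
  | zero => simpa using hu
  | succ j ih =>
    rw [iteratedDeriv_succ']
    apply ih
    have : ContDiffAt ℝ ∞ (fun s => fderiv ℝ u s 1) t :=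
      (hu.fderiv_right (m := ∞) le_rfl).clm_apply contDiffAt_const
    simpa using this

theorem contDiffAt_deriv {u : ℝ → E} {t : ℝ} (hu : ContDiffAt ℝ ∞ u t) :
    ContDiffAt ℝ ∞ (deriv u) t := by
  simpa using contDiffAt_iteratedDeriv hu 1

theorem eventually_contDiffAt {f : X → F} {z : X} (hf : ContDiffAt ℝ ∞ f z) (m : ℕ) :
    ∀ᶠ y in 𝓝 z, ContDiffAt ℝ m f y :=
  (hf.of_le (by exact_mod_cast le_top)).eventually (by simp)

theorem hasDerivAt_comp_mk_right {f : X × ℝ → F} {p : X × ℝ} (hf : DifferentiableAt ℝ f p) :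
    HasDerivAt (fun r => f (p.1, r)) (fderiv ℝ f p (0, 1)) p.2 := by
  have h1 : HasDerivAt (fun r : ℝ => (p.1, r)) ((0 : X), (1 : ℝ)) p.2 :=
    (hasDerivAt_const _ _).prodMk (hasDerivAt_id _)
  exact HasFDerivAt.comp_hasDerivAt_of_eq (x := p.2) hf.hasFDerivAt h1 rfl

theorem hasDerivAt_comp_mk_left {f : ℝ × X → F} {p : ℝ × X} (hf : DifferentiableAt ℝ f p) :
    HasDerivAt (fun r => f (r, p.2)) (fderiv ℝ f p (1, 0)) p.1 := by
  have h1 : HasDerivAt (fun r : ℝ => (r, p.2)) ((1 : ℝ), (0 : X)) p.1 :=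
    (hasDerivAt_id _).prodMk (hasDerivAt_const _ _)
  exact HasFDerivAt.comp_hasDerivAt_of_eq (x := p.1) hf.hasFDerivAt h1 rfl

theorem contDiffAt_deriv_right {f : X × ℝ → F} {z : X × ℝ} (hf : ContDiffAt ℝ ∞ f z) :
    ContDiffAt ℝ ∞ (fun p : X × ℝ => deriv (fun r => f (p.1, r)) p.2) z := by
  have h1 : ContDiffAt ℝ ∞ (fun p => fderiv ℝ f p (0, 1)) z :=
    (hf.fderiv_right (m := ∞) le_rfl).clm_apply contDiffAt_const
  refine h1.congr_of_eventuallyEq ?_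
  filter_upwards [eventually_contDiffAt hf 1] with p hp
  exact (hasDerivAt_comp_mk_right (hp.differentiableAt (by simp))).deriv

theorem contDiffAt_deriv_left {f : ℝ × X → F} {z : ℝ × X} (hf : ContDiffAt ℝ ∞ f z) :
    ContDiffAt ℝ ∞ (fun p : ℝ × X => deriv (fun r => f (r, p.2)) p.1) z := by
  have h1 : ContDiffAt ℝ ∞ (fun p => fderiv ℝ f p (1, 0)) z :=
    (hf.fderiv_right (m := ∞) le_rfl).clm_apply contDiffAt_const
  refine h1.congr_of_eventuallyEq ?_
  filter_upwards [eventually_contDiffAt hf 1] with p hp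
  exact (hasDerivAt_comp_mk_left (hp.differentiableAt (by simp))).deriv

theorem contDiffAt_iteratedDeriv_right {f : X × ℝ → F} {z : X × ℝ} (hf : ContDiffAt ℝ ∞ f z)
    (j : ℕ) :
    ContDiffAt ℝ ∞ (fun p : X × ℝ => iteratedDeriv j (fun r => f (p.1, r)) p.2) z := by
  induction j generalizing f with
  | zero => simpa using hf
  | succ j ih =>
    simp only [iteratedDeriv_succ']
    exact ih (contDiffAt_deriv_right hf)

theorem deriv_deriv_swap {f : ℝ × ℝ → F} {z : ℝ × ℝ} (hf : ContDiffAt ℝ 2 f z) :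
    deriv (fun ε => deriv (fun t => f (ε, t)) z.2) z.1 =
      deriv (fun t => deriv (fun ε => f (ε, t)) z.1) z.2 := by
  have hev : ∀ᶠ p in 𝓝 z, DifferentiableAt ℝ f p :=
    (hf.eventually (by simp)).mono fun p hp => hp.differentiableAt (by simp)
  have hd : DifferentiableAt ℝ (fderiv ℝ f) z :=
    (hf.fderiv_right (m := 1) (by norm_num)).differentiableAt (by simp)
  have c1 : Tendsto (fun ε : ℝ => (ε, z.2)) (𝓝 z.1) (𝓝 z) := by
    have : ContinuousAt (fun ε : ℝ => (ε, z.2)) z.1 := by fun_prop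
    exact this
  have c2 : Tendsto (fun t : ℝ => (z.1, t)) (𝓝 z.2) (𝓝 z) := by
    have : ContinuousAt (fun t : ℝ => (z.1, t)) z.2 := by fun_prop
    exact this
  have e1 : (fun ε => deriv (fun t => f (ε, t)) z.2) =ᶠ[𝓝 z.1]
      fun ε => fderiv ℝ f (ε, z.2) (0, 1) := by
    filter_upwards [c1.eventually hev] with ε hε
    exact (hasDerivAt_comp_mk_right hε).deriv
  have e2 : (fun t => deriv (fun ε => f (ε, t)) z.1) =ᶠ[𝓝 z.2]
      fun t => fderiv ℝ f (z.1, t) (1, 0) := by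
    filter_upwards [c2.eventually hev] with t ht
    exact (hasDerivAt_comp_mk_left ht).deriv
  rw [e1.deriv_eq, e2.deriv_eq]
  have h1 := ((hasDerivAt_comp_mk_left hd).clm_apply (hasDerivAt_const z.1 ((0 : ℝ), (1 : ℝ)))).deriv
  have h2 := ((hasDerivAt_comp_mk_right hd).clm_apply (hasDerivAt_const z.2 ((1 : ℝ), (0 : ℝ)))).deriv
  rw [h1, h2]
  simpa using (hf.isSymmSndFDerivAt (by simp)).eq (1, 0) (0, 1)

/-- Symmetry of second derivatives, iterated: the variation of the jet of a curve is the jet of its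
variation. -/
theorem deriv_iteratedDeriv_swap {f : ℝ × ℝ → F} {z : ℝ × ℝ} (hf : ContDiffAt ℝ ∞ f z) (j : ℕ) :
    deriv (fun ε => iteratedDeriv j (fun t => f (ε, t)) z.2) z.1 =
      iteratedDeriv j (fun t => deriv (fun ε => f (ε, t)) z.1) z.2 := by
  induction j generalizing f with
  | zero => simp
  | succ j ih =>
    simp only [iteratedDeriv_succ']
    rw [ih (contDiffAt_deriv_right hf)]
    refine Filter.EventuallyEq.iteratedDeriv_eq j ?_
    have c2 : Tendsto (fun t : ℝ => (z.1, t)) (𝓝 z.2) (𝓝 z) := by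
      have : ContinuousAt (fun t : ℝ => (z.1, t)) z.2 := by fun_prop
      exact this
    filter_upwards [c2.eventually (eventually_contDiffAt hf 2)] with t ht
    exact deriv_deriv_swap (z := (z.1, t)) ht

/-- Being C¹ is an open condition and the segment is compact, so by the tube lemma `Φ` is C¹ on a
whole strip around ε = 0. On a compact strip the ε-derivative is bounded, which is the domination
required. -/
theorem hasDerivAt_intervalIntegral_of_contDiffAt {Φ : ℝ × ℝ → ℝ} {a b : ℝ} (hab : a ≤ b)
    (h : ∀ t ∈ Icc a b, ContDiffAt ℝ 1 Φ (0, t)) :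
    HasDerivAt (fun ε => ∫ t in a..b, Φ (ε, t)) (∫ t in a..b, deriv (fun ε => Φ (ε, t)) 0) 0 := by
  set W : Set (ℝ × ℝ) := {z | ContDiffAt ℝ 1 Φ z}
  have hW : IsOpen W := isOpen_iff_mem_nhds.2 fun z (hz : ContDiffAt ℝ 1 Φ z) =>
    hz.eventually (by simp)
  obtain ⟨u, v, hu, hv, h0u, hIv, huv⟩ := generalized_tube_lemma (s := {(0 : ℝ)})
    isCompact_singleton (t := Icc a b) isCompact_Icc hW (by
      rintro ⟨x, t⟩ ⟨hx, ht⟩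
      obtain rfl : x = 0 := hx
      exact h t ht)
  obtain ⟨δ, hδ, hδu⟩ := Metric.nhds_basis_closedBall.mem_iff.1 (hu.mem_nhds (h0u rfl))
  have hsub : Metric.closedBall (0 : ℝ) δ ×ˢ Icc a b ⊆ W :=
    (prod_mono hδu hIv).trans huv
  have hcomp : IsCompact (Metric.closedBall (0 : ℝ) δ ×ˢ Icc a b) :=
    (isCompact_closedBall _ _).prod isCompact_Icc
  have hc1 : ContinuousOn Φ (Metric.closedBall (0 : ℝ) δ ×ˢ Icc a b) := fun z hz =>
    ((show ContDiffAt ℝ 1 Φ z from hsub hz).continuousAt).continuousWithinAt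
  have hc2 : ContinuousOn (fun z => fderiv ℝ Φ z (1, 0)) (Metric.closedBall (0 : ℝ) δ ×ˢ Icc a b) :=
    fun z hz => by
      have hz' : ContDiffAt ℝ 1 Φ z := hsub hz
      have h1 : ContinuousAt (fderiv ℝ Φ) z :=
        (hz'.fderiv_right (m := 0) (by norm_num)).continuousAt
      exact (h1.clm_apply continuousAt_const).continuousWithinAt
  obtain ⟨C, hC⟩ := hcomp.exists_bound_of_continuousOn hc2
  have hslice : ∀ ε ∈ Metric.closedBall (0 : ℝ) δ, ∀ {g : ℝ × ℝ → ℝ},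
      ContinuousOn g (Metric.closedBall (0 : ℝ) δ ×ˢ Icc a b) →
      ContinuousOn (fun t => g (ε, t)) (uIcc a b) := by
    intro ε hε g hg
    rw [uIcc_of_le hab]
    exact hg.comp (by fun_prop) fun t ht => ⟨hε, ht⟩
  have key := intervalIntegral.hasDerivAt_integral_of_dominated_loc_of_deriv_le (μ := volume)
    (F := fun ε t => Φ (ε, t)) (F' := fun ε t => fderiv ℝ Φ (ε, t) (1, 0)) (x₀ := (0 : ℝ))
    (s := Metric.closedBall (0 : ℝ) δ) (a := a) (b := b) (bound := fun _ => C)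
    (Metric.closedBall_mem_nhds _ hδ)
    (by
      filter_upwards [Metric.closedBall_mem_nhds (0 : ℝ) hδ] with ε hε
      exact ((hslice ε hε hc1).intervalIntegrable).def'.aestronglyMeasurable)
    ((hslice 0 (Metric.mem_closedBall_self hδ.le) hc1).intervalIntegrable)
    ((hslice 0 (Metric.mem_closedBall_self hδ.le) hc2).intervalIntegrable).def'.aestronglyMeasurable
    (by
      refine Eventually.of_forall fun t ht ε hε => hC (ε, t) ⟨hε, ?_⟩
      rw [uIoc_of_le hab] at ht
      exact Ioc_subset_Icc_self ht)
    intervalIntegrable_const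
    (by
      refine Eventually.of_forall fun t ht ε hε => ?_
      rw [uIoc_of_le hab] at ht
      have : ContDiffAt ℝ 1 Φ (ε, t) := hsub ⟨hε, Ioc_subset_Icc_self ht⟩
      exact hasDerivAt_comp_mk_left (f := Φ) (p := (ε, t)) (this.differentiableAt (by simp)))
  have e : ∫ t in a..b, deriv (fun ε => Φ (ε, t)) 0 = ∫ t in a..b, fderiv ℝ Φ (0, t) (1, 0) := by
    refine intervalIntegral.integral_congr fun t ht => ?_
    rw [uIcc_of_le hab] at ht
    exact (hasDerivAt_comp_mk_left (f := Φ) (p := ((0 : ℝ), t))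
      ((h t ht).differentiableAt (by simp))).deriv
  rw [e]
  exact key.2

/-- Variations agree with the given curve only on the closed interval, so derivatives can be
compared only at interior times; the endpoints are null. -/
theorem intervalIntegral_congr_Ioo {f g : ℝ → E} {a b : ℝ} (hab : a ≤ b)
    (h : ∀ t ∈ Ioo a b, f t = g t) : ∫ t in a..b, f t = ∫ t in a..b, g t := by
  rw [intervalIntegral.integral_of_le hab, intervalIntegral.integral_of_le hab,
    integral_Ioc_eq_integral_Ioo, integral_Ioc_eq_integral_Ioo]
  exact setIntegral_congr_fun measurableSet_Ioo h

theorem intervalIntegrable_of_contDiffAt {f : ℝ → ℝ} {a b : ℝ} (hab : a ≤ b)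
    (h : ∀ t ∈ Icc a b, ContDiffAt ℝ ∞ f t) : IntervalIntegrable f volume a b := by
  refine ContinuousOn.intervalIntegrable fun t ht => ?_
  rw [uIcc_of_le hab] at ht
  exact (h t ht).continuousAt.continuousWithinAt

/-- Each step moves the outermost derivative of `w` onto `A`; its boundary term contains a
derivative of `w` of order below `j`, hence vanishes. -/
theorem integral_iteratedDeriv_by_parts {A : ℝ → E →L[ℝ] ℝ} {w : ℝ → E} {a b : ℝ} (hab : a ≤ b)
    (hA : ∀ t ∈ Icc a b, ContDiffAt ℝ ∞ A t) (hw : ∀ t ∈ Icc a b, ContDiffAt ℝ ∞ w t) (j : ℕ)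
    (ha : ∀ i < j, iteratedDeriv i w a = 0) (hb : ∀ i < j, iteratedDeriv i w b = 0) :
    ∫ t in a..b, A t (iteratedDeriv j w t) =
      ∫ t in a..b, ((-1 : ℝ) ^ j • iteratedDeriv j A t) (w t) := by
  induction j generalizing A with
  | zero => simp
  | succ j ih =>
    have hw' : ∀ t ∈ Icc a b, ContDiffAt ℝ ∞ (iteratedDeriv j w) t := fun t ht =>
      contDiffAt_iteratedDeriv (hw t ht) j
    have hder : ∀ t ∈ uIcc a b, HasDerivAt (fun t => A t (iteratedDeriv j w t))
        (deriv A t (iteratedDeriv j w t) + A t (iteratedDeriv (j + 1) w t)) t := by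
      intro t ht
      rw [uIcc_of_le hab] at ht
      rw [iteratedDeriv_succ]
      exact ((hA t ht).differentiableAt (by simp)).hasDerivAt.clm_apply
        ((hw' t ht).differentiableAt (by simp)).hasDerivAt
    have i1 : IntervalIntegrable (fun t => deriv A t (iteratedDeriv j w t)) volume a b :=
      intervalIntegrable_of_contDiffAt hab fun t ht =>
        (contDiffAt_deriv (hA t ht)).clm_apply (hw' t ht)
    have i2 : IntervalIntegrable (fun t => A t (iteratedDeriv (j + 1) w t)) volume a b :=
      intervalIntegrable_of_contDiffAt hab fun t ht =>
        (hA t ht).clm_apply (contDiffAt_iteratedDeriv (hw t ht) _)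
    have h0 := intervalIntegral.integral_eq_sub_of_hasDerivAt hder (i1.add i2)
    rw [intervalIntegral.integral_add i1 i2, ha j (Nat.lt_succ_self j),
      hb j (Nat.lt_succ_self j)] at h0
    have h1 := ih (fun t ht => contDiffAt_deriv (hA t ht)) (fun i hi => ha i (by omega))
      (fun i hi => hb i (by omega))
    simp only [map_zero, sub_zero] at h0
    rw [h1] at h0
    rw [eq_neg_of_add_eq_zero_right h0, ← intervalIntegral.integral_neg]
    refine intervalIntegral.integral_congr fun t _ => ?_
    simp [iteratedDeriv_succ', pow_succ]

theorem derivTuple_congr {n : ℕ} {x y : ℝ → E} {t : ℝ} (h : x =ᶠ[𝓝 t] y) :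
    derivTuple n x t = derivTuple n y t :=
  funext fun i => h.iteratedDeriv_eq i

theorem contDiffAt_derivTuple {x : ℝ → E} {t : ℝ} (hx : ContDiffAt ℝ ∞ x t) (n : ℕ) :
    ContDiffAt ℝ ∞ (derivTuple n x) t :=
  contDiffAt_pi.2 fun i => contDiffAt_iteratedDeriv hx i

theorem contDiffAt_partialD {n : ℕ} {f : (Fin n → E) → ℝ} {y : Fin n → E}
    (hf : ContDiffAt ℝ ∞ f y) (j : Fin n) : ContDiffAt ℝ ∞ (partialD f j) y :=
  (hf.fderiv_right (m := ∞) le_rfl).clm_comp contDiffAt_const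

theorem contDiffAt_partialD_derivTuple {n : ℕ} {f : (Fin n → E) → ℝ} {x : ℝ → E} {t : ℝ}
    (hx : ContDiffAt ℝ ∞ x t) (hf : ContDiffAt ℝ ∞ f (derivTuple n x t)) (j : Fin n) :
    ContDiffAt ℝ ∞ (fun s => partialD f j (derivTuple n x s)) t :=
  ContDiffAt.comp t (contDiffAt_partialD hf j) (contDiffAt_derivTuple hx n)

theorem contDiffAt_eulerOperator {n : ℕ} {f : (Fin n → E) → ℝ} {x : ℝ → E} {t : ℝ}
    (hx : ContDiffAt ℝ ∞ x t) (hf : ContDiffAt ℝ ∞ f (derivTuple n x t)) :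
    ContDiffAt ℝ ∞ (eulerOperator f x) t :=
  ContDiffAt.sum fun j _ => (contDiffAt_iteratedDeriv
    (contDiffAt_partialD_derivTuple hx hf j) j).const_smul ((-1 : ℝ) ^ (j : ℕ))

theorem fderiv_apply_eq_sum_partialD {n : ℕ} (f : (Fin n → E) → ℝ) (y v : Fin n → E) :
    fderiv ℝ f y v = ∑ j, partialD f j y (v j) := by
  simp only [partialD, ContinuousLinearMap.comp_apply, ContinuousLinearMap.single_apply]
  rw [← map_sum, Finset.univ_sum_single]

/-- The first variation of the action `∫ f(x, ẋ, …, x^(n-1)) dt`. -/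
theorem hasDerivAt_action {n : ℕ} {f : (Fin n → E) → ℝ} {x : ℝ → ℝ → E} {ξ w : ℝ → E} {a b : ℝ}
    (hab : a ≤ b)
    (hx : ∀ t ∈ Icc a b, ContDiffAt ℝ ∞ (fun p : ℝ × ℝ => x p.1 p.2) (0, t))
    (hξ : ∀ t ∈ Icc a b, ContDiffAt ℝ ∞ ξ t) (hw : ∀ t ∈ Icc a b, ContDiffAt ℝ ∞ w t)
    (hf : ∀ t ∈ Icc a b, ContDiffAt ℝ ∞ f (derivTuple n (x 0) t))
    (hf' : ∀ t ∈ Icc a b, ContDiffAt ℝ ∞ f (derivTuple n ξ t))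
    (hx0 : ∀ t ∈ Ioo a b, x 0 t = ξ t)
    (hxw : ∀ t ∈ Ioo a b, deriv (fun ε => x ε t) 0 = w t)
    (ha : ∀ i, i + 1 < n → iteratedDeriv i w a = 0)
    (hb : ∀ i, i + 1 < n → iteratedDeriv i w b = 0) :
    HasDerivAt (fun ε => ∫ t in a..b, f (derivTuple n (x ε) t))
      (∫ t in a..b, eulerOperator f ξ t (w t)) 0 := by
  have hy : ∀ t ∈ Icc a b, ContDiffAt ℝ ∞ (fun p : ℝ × ℝ => derivTuple n (x p.1) p.2) (0, t) :=
    fun t ht => contDiffAt_pi.2 fun i => contDiffAt_iteratedDeriv_right (hx t ht) i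
  have hΦ : ∀ t ∈ Icc a b,
      ContDiffAt ℝ 1 (fun p : ℝ × ℝ => f (derivTuple n (x p.1) p.2)) (0, t) := fun t ht =>
    (ContDiffAt.comp ((0 : ℝ), t) (hf t ht) (hy t ht)).of_le (by exact_mod_cast le_top)
  have key := hasDerivAt_intervalIntegral_of_contDiffAt hab hΦ
  convert key using 1
  -- Chain rule at interior times, where equality of curves on a neighbourhood gives equality of
  -- jets. This replaces the jets of `x 0` and of δx by those of `ξ` and `w`.
  have h1 : ∫ t in a..b, deriv (fun ε => f (derivTuple n (x ε) t)) 0 =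
      ∫ t in a..b, ∑ j : Fin n, partialD f j (derivTuple n ξ t) (iteratedDeriv j w t) := by
    refine intervalIntegral_congr_Ioo hab fun t ht => ?_
    have ht' := Ioo_subset_Icc_self ht
    have hnhds : Ioo a b ∈ 𝓝 t := isOpen_Ioo.mem_nhds ht
    have hd : HasDerivAt (fun ε => derivTuple n (x ε) t) (derivTuple n w t) 0 := by
      refine hasDerivAt_pi.2 fun i => ?_
      have hh : ContDiffAt ℝ ∞ (fun p : ℝ × ℝ => iteratedDeriv i (x p.1) p.2) (0, t) :=
        contDiffAt_iteratedDeriv_right (hx t ht') i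
      have h2 := (hasDerivAt_comp_mk_left (hh.differentiableAt (by simp))).differentiableAt.hasDerivAt
      have h3 := deriv_iteratedDeriv_swap (hx t ht') i
      simp only at h2 h3
      rw [h3] at h2
      have e : derivTuple n w t i = iteratedDeriv i (fun s => deriv (fun ε => x ε s) 0) t := by
        refine Filter.EventuallyEq.iteratedDeriv_eq _ ?_
        filter_upwards [hnhds] with s hs using (hxw s hs).symm
      rw [e]
      exact h2
    have hfd : HasFDerivAt f (fderiv ℝ f (derivTuple n (x 0) t)) (derivTuple n (x 0) t) :=
      ((hf t ht').differentiableAt (by simp)).hasFDerivAt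
    have h4 := hfd.comp_hasDerivAt (0 : ℝ) hd
    have h5 : derivTuple n (x 0) t = derivTuple n ξ t :=
      derivTuple_congr (by filter_upwards [hnhds] with s hs using hx0 s hs)
    have h6 := h4.deriv
    simp only [Function.comp_def] at h6
    rw [h6, fderiv_apply_eq_sum_partialD, h5]
    rfl
  have hA := fun j t ht => contDiffAt_partialD_derivTuple (hξ t ht) (hf' t ht) j
  simp only [h1]
  rw [intervalIntegral.integral_finsetSum fun j _ => intervalIntegrable_of_contDiffAt hab
    fun t ht => (hA j t ht).clm_apply (contDiffAt_iteratedDeriv (hw t ht) j)]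
  have h2 : ∀ j : Fin n, ∫ t in a..b, partialD f j (derivTuple n ξ t) (iteratedDeriv j w t) =
      ∫ t in a..b, ((-1 : ℝ) ^ (j : ℕ) •
        iteratedDeriv j (fun s => partialD f j (derivTuple n ξ s)) t) (w t) := fun j =>
    integral_iteratedDeriv_by_parts hab (hA j) hw j (fun i hi => ha i (by omega))
      (fun i hi => hb i (by omega))
  simp only [h2]
  rw [← intervalIntegral.integral_finsetSum fun j _ => intervalIntegrable_of_contDiffAt hab
    fun t ht => ((contDiffAt_iteratedDeriv (hA j t ht) j).const_smul ((-1 : ℝ) ^ (j : ℕ))).clm_apply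
      (hw t ht)]
  refine intervalIntegral.integral_congr fun t _ => ?_
  simp [eulerOperator]

/-- The fundamental lemma of the calculus of variations, for continuous covectors. -/
theorem eq_zero_of_integral_apply_eq_zero {μ : ℝ → E → ℝ} {a b : ℝ} (hab : a ≤ b)
    (hμ : ∀ v, ContinuousOn (fun t => μ t v) (Ioo a b))
    (hsmul : ∀ t (c : ℝ) v, μ t (c • v) = c * μ t v)
    (h : ∀ η : ℝ → E, ContDiff ℝ ∞ η → tsupport η ⊆ Ioo a b → ∫ t in a..b, μ t (η t) = 0) :
    ∀ t ∈ Ioo a b, ∀ v, μ t v = 0 := by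
  intro t ht v
  have hae : ∀ᵐ s ∂(volume : Measure ℝ), s ∈ Ioo a b → μ s v = 0 := by
    refine isOpen_Ioo.ae_eq_zero_of_integral_contDiff_smul_eq_zero
      ((hμ v).locallyIntegrableOn measurableSet_Ioo) fun g hg hgs hgt => ?_
    have h1 := h (fun t => g t • v) (hg.smul contDiff_const) (by
      refine (closure_mono fun s hs => ?_).trans hgt
      simp only [Function.mem_support] at hs ⊢
      exact fun h0 => hs (by simp [h0]))
    simp only [hsmul] at h1
    rw [intervalIntegral.integral_of_le hab, integral_Ioc_eq_integral_Ioo] at h1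
    rw [← h1, setIntegral_eq_integral_of_forall_compl_eq_zero]
    · simp
    · intro s hs
      rw [image_eq_zero_of_notMem_tsupport fun hs' => hs (hgt hs'), zero_mul]
  -- Testing against scalar bumps times the fixed vector `v` yields vanishing almost everywhere
  -- only; continuity upgrades it to every point.
  have hae' : (fun s => μ s v) =ᵐ[volume.restrict (Ioo a b)] fun _ => 0 :=
    (ae_restrict_iff' measurableSet_Ioo).2 hae
  exact Measure.eqOn_open_of_ae_eq hae' isOpen_Ioo (hμ v) continuousOn_const ht

end Calculus

/-! ### Jets and Lagrangians in charts. -/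

section Charts

variable {E : Type*} [NormedAddCommGroup E] [NormedSpace ℝ E]
variable {X : Type*} [NormedAddCommGroup X] [NormedSpace ℝ X]
variable {M : Type*} [TopologicalSpace M] [ChartedSpace E M]

theorem contMDiffAt_chart {e : OpenPartialHomeomorph M E} (he : e ∈ smoothCharts E M) {x : M}
    (hx : x ∈ e.source) : ContMDiffAt 𝓘(ℝ, E) 𝓘(ℝ, E) ∞ e x :=
  contMDiffAt_of_mem_maximalAtlas he hx

theorem contMDiffAt_chart_symm {e : OpenPartialHomeomorph M E} (he : e ∈ smoothCharts E M) {y : E}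
    (hy : y ∈ e.target) : ContMDiffAt 𝓘(ℝ, E) 𝓘(ℝ, E) ∞ e.symm y :=
  contMDiffAt_symm_of_mem_maximalAtlas he hy

theorem contDiffAt_chart_comp {e : OpenPartialHomeomorph M E} (he : e ∈ smoothCharts E M)
    {n : ℕ∞} {c : X → M} {x : X} (hc : ContMDiffAt 𝓘(ℝ, X) 𝓘(ℝ, E) n c x) (hx : c x ∈ e.source) :
    ContDiffAt ℝ n (fun y => e (c y)) x :=
  (((contMDiffAt_chart he hx).of_le (by exact_mod_cast le_top)).comp x hc).contDiffAt

theorem contMDiffAt_chart_symm_comp {e : OpenPartialHomeomorph M E} (he : e ∈ smoothCharts E M)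
    {n : ℕ∞} {u : X → E} {x : X} (hu : ContDiffAt ℝ n u x) (hx : u x ∈ e.target) :
    ContMDiffAt 𝓘(ℝ, X) 𝓘(ℝ, E) n (fun y => e.symm (u y)) x :=
  ((contMDiffAt_chart_symm he hx).of_le (by exact_mod_cast le_top)).comp x hu.contMDiffAt

theorem contMDiffAt_comp_const_add {n : ℕ∞} {c : ℝ → M} {t : ℝ}
    (hc : ContMDiffAt 𝓘(ℝ, ℝ) 𝓘(ℝ, E) n c t) :
    ContMDiffAt 𝓘(ℝ, ℝ) 𝓘(ℝ, E) n (fun s => c (t + s)) 0 := by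
  have h : ContDiffAt ℝ n (fun s : ℝ => t + s) 0 := by fun_prop
  exact ContMDiffAt.comp_of_eq hc h.contMDiffAt (by simp)

theorem lagrangianAlong_of_contMDiffAt {k : ℕ} (L : HigherTangent E k M → ℝ) {c : ℝ → M} {t : ℝ}
    (hc : ContMDiffAt 𝓘(ℝ, ℝ) 𝓘(ℝ, E) (k : ℕ∞) c t) :
    lagrangianAlong L c t = L (jetMk ⟨fun s => c (t + s), contMDiffAt_comp_const_add hc⟩) :=
  dif_pos (contMDiffAt_comp_const_add hc)

/-- Equality of jets can be tested in a single chart. -/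
theorem jetMk_eq_of_chart {k : ℕ} {c₁ c₂ : JetCurve E k M} {e : OpenPartialHomeomorph M E}
    (he : e ∈ smoothCharts E M) (hs : c₁.1 0 ∈ e.source) (h0 : c₁.1 0 = c₂.1 0)
    (h : ∀ l ≤ k, iteratedDeriv l (fun s => e (c₁.1 s)) 0 = iteratedDeriv l (fun s => e (c₂.1 s)) 0) :
    jetMk c₁ = jetMk c₂ := by
  refine Quotient.sound ⟨h0, fun e' he' hs' l _ hl => ?_⟩
  -- Near time 0 the expression in another chart is the transition map applied to the expression in
  -- `e`, and composition with a smooth map respects jets.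
  have key := iteratedDeriv_comp_congr (H := fun y => e' (e.symm y)) (u := fun s => e (c₁.1 s))
    (v := fun s => e (c₂.1 s)) (t := 0) (m := k) ?_
    (by exact_mod_cast contDiffAt_chart_comp he c₁.2 hs)
    (by exact_mod_cast contDiffAt_chart_comp he c₂.2 (h0 ▸ hs)) h l hl
  · have aux : ∀ c : JetCurve E k M, c.1 0 ∈ e.source →
        (fun s => e' (c.1 s)) =ᶠ[𝓝 0] fun s => e' (e.symm (e (c.1 s))) := by
      intro c hc
      filter_upwards [c.2.continuousAt.preimage_mem_nhds (e.open_source.mem_nhds hc)] with s hs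
      rw [e.left_inv hs]
    rw [(aux c₁ hs).iteratedDeriv_eq l, (aux c₂ (h0 ▸ hs)).iteratedDeriv_eq l, key]
  · have h1 : ContMDiffAt 𝓘(ℝ, E) 𝓘(ℝ, E) (k : ℕ∞) e.symm (e (c₁.1 0)) :=
      (contMDiffAt_chart_symm he (e.map_source hs)).of_le (by exact_mod_cast le_top)
    exact_mod_cast contDiffAt_chart_comp he' h1 (by rwa [e.left_inv hs])

theorem lagrangianAlong_congr {k : ℕ} (L : HigherTangent E k M → ℝ) {c₁ c₂ : ℝ → M} {t₁ t₂ : ℝ}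
    {e : OpenPartialHomeomorph M E} (he : e ∈ smoothCharts E M)
    (h1 : ContMDiffAt 𝓘(ℝ, ℝ) 𝓘(ℝ, E) (k : ℕ∞) c₁ t₁)
    (h2 : ContMDiffAt 𝓘(ℝ, ℝ) 𝓘(ℝ, E) (k : ℕ∞) c₂ t₂)
    (hs : c₁ t₁ ∈ e.source) (h0 : c₁ t₁ = c₂ t₂)
    (h : ∀ l ≤ k, iteratedDeriv l (fun s => e (c₁ s)) t₁ = iteratedDeriv l (fun s => e (c₂ s)) t₂) :
    lagrangianAlong L c₁ t₁ = lagrangianAlong L c₂ t₂ := by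
  rw [lagrangianAlong_of_contMDiffAt L h1, lagrangianAlong_of_contMDiffAt L h2]
  congr 1
  refine jetMk_eq_of_chart he (by simpa using hs) (by simpa using h0) fun l hl => ?_
  have a1 := congrFun (iteratedDeriv_comp_const_add l (fun s => e (c₁ s)) t₁) 0
  have a2 := congrFun (iteratedDeriv_comp_const_add l (fun s => e (c₂ s)) t₂) 0
  simp only [add_zero] at a1 a2
  rw [a1, a2, h l hl]

/-- The polynomial curve with prescribed derivatives at `0`. -/
def taylorCurve {n : ℕ} (q : Fin n → E) (s : ℝ) : E :=
  ∑ j : Fin n, (s ^ (j : ℕ) / (Nat.factorial j : ℝ)) • q j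

theorem contDiff_taylorCurve {n : ℕ} :
    ContDiff ℝ ∞ (fun p : (Fin n → E) × ℝ => taylorCurve p.1 p.2) := by
  unfold taylorCurve
  refine ContDiff.sum fun j _ => ContDiff.smul (by fun_prop) ?_
  exact (contDiff_apply ℝ E j).comp contDiff_fst

theorem contDiffAt_taylorCurve {n : ℕ} (q : Fin n → E) (s : ℝ) : ContDiffAt ℝ ∞ (taylorCurve q) s :=
  (contDiff_taylorCurve.comp (contDiff_prodMk_right q)).contDiffAt

/-- At 0 only the monomial of degree `i` contributes to the `i`-th derivative, and the factorial
normalizes it. -/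
theorem iteratedDeriv_taylorCurve {n : ℕ} (q : Fin n → E) (i : Fin n) :
    iteratedDeriv i (taylorCurve q) 0 = q i := by
  have hp : ∀ j : Fin n, ContDiffAt ℝ (i : ℕ) (fun s : ℝ => s ^ (j : ℕ) / (Nat.factorial j : ℝ)) 0 := by
    intro j
    fun_prop
  have h0 : ∀ j : Fin n, iteratedDeriv i
      (fun s : ℝ => (s ^ (j : ℕ) / (Nat.factorial j : ℝ)) • q j) 0 = if j = i then q j else 0 := by
    intro j
    have e1 := iteratedDeriv_smul_const (hp j) (q j)
    have e2 : iteratedDeriv i (fun s : ℝ => s ^ (j : ℕ) / (Nat.factorial j : ℝ)) 0 =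
        if j = i then 1 else 0 := by
      rw [iteratedDeriv_div_const, iteratedDeriv_fun_pow_zero]
      by_cases hij : j = i
      · subst hij
        have : (Nat.factorial j : ℝ) ≠ 0 := by positivity
        simp [this]
      · have : (i : ℕ) ≠ j := fun h => hij (Fin.ext h.symm)
        simp [hij, this]
    rw [e2] at e1
    rw [e1]
    split_ifs <;> simp
  have hs : ∀ j ∈ (Finset.univ : Finset (Fin n)), ContDiffAt ℝ (i : ℕ)
      (fun s : ℝ => (s ^ (j : ℕ) / (Nat.factorial j : ℝ)) • q j) 0 :=
    fun j _ => (hp j).smul contDiffAt_const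
  unfold taylorCurve
  rw [iteratedDeriv_fun_sum hs]
  simp [h0]

theorem taylorCurve_zero {n : ℕ} (q : Fin (n + 1) → E) : taylorCurve q 0 = q 0 := by
  simpa using iteratedDeriv_taylorCurve q 0

theorem localLagrangian_eq {k : ℕ} (L : HigherTangent E k M → ℝ) (e : OpenPartialHomeomorph M E)
    (q : Fin (k + 1) → E) :
    localLagrangian L e q = lagrangianAlong L (fun s => e.symm (taylorCurve q s)) 0 := rfl

theorem contMDiffAt_chart_symm_taylorCurve {e : OpenPartialHomeomorph M E}
    (he : e ∈ smoothCharts E M) {k : ℕ} {q : Fin (k + 1) → E} (hq : q 0 ∈ e.target) :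
    ContMDiffAt 𝓘(ℝ, ℝ) 𝓘(ℝ, E) (k : ℕ∞) (fun s => e.symm (taylorCurve q s)) 0 :=
  contMDiffAt_chart_symm_comp he
    ((contDiffAt_taylorCurve q 0).of_le (by exact_mod_cast le_top))
    (by rwa [taylorCurve_zero])

theorem chart_taylorCurve_eventuallyEq {M : Type*} [TopologicalSpace M] {e : OpenPartialHomeomorph M E}
    {k : ℕ} {q : Fin (k + 1) → E} (hq : q 0 ∈ e.target) :
    (fun s => e (e.symm (taylorCurve q s))) =ᶠ[𝓝 0] taylorCurve q := by
  have hc : ContinuousAt (taylorCurve q) 0 := (contDiffAt_taylorCurve q 0).continuousAt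
  filter_upwards [hc.preimage_mem_nhds
    (e.open_target.mem_nhds (by rwa [taylorCurve_zero]))] with s hs
  exact e.right_inv hs

/-- In the chart, `c` at time `t` has the same `k`-jet as the Taylor polynomial used to define the
local expression of `L`, and `L` sees only the jet. -/
theorem lagrangianAlong_eq_localLagrangian {k : ℕ} (L : HigherTangent E k M → ℝ)
    {e : OpenPartialHomeomorph M E} (he : e ∈ smoothCharts E M) {c : ℝ → M} {t : ℝ}
    (hc : ContMDiffAt 𝓘(ℝ, ℝ) 𝓘(ℝ, E) (k : ℕ∞) c t) (hs : c t ∈ e.source) :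
    lagrangianAlong L c t = localLagrangian L e (derivTuple (k + 1) (fun s => e (c s)) t) := by
  have hq : derivTuple (k + 1) (fun s => e (c s)) t 0 ∈ e.target := by
    simpa [derivTuple] using e.map_source hs
  rw [localLagrangian_eq]
  refine lagrangianAlong_congr L he hc (contMDiffAt_chart_symm_taylorCurve he hq) hs ?_ ?_
  · rw [taylorCurve_zero]
    simp [derivTuple, e.left_inv hs]
  · intro l hl
    rw [(chart_taylorCurve_eventuallyEq hq).iteratedDeriv_eq l]
    exact (iteratedDeriv_taylorCurve (derivTuple (k + 1) (fun s => e (c s)) t)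
      ⟨l, Nat.lt_succ_of_le hl⟩).symm

theorem contDiffAt_localLagrangian {k : ℕ} {L : HigherTangent E k M → ℝ} (hL : IsSmoothLagrangian L)
    {e : OpenPartialHomeomorph M E} (he : e ∈ smoothCharts E M) {q : Fin (k + 1) → E}
    (hq : q 0 ∈ e.target) : ContDiffAt ℝ ∞ (localLagrangian L e) q :=
  (hL e he).contDiffAt ((e.open_target.preimage (continuous_apply 0)).mem_nhds hq)

theorem chartAt_mem_smoothCharts [IsManifold 𝓘(ℝ, E) ∞ M] (x : M) : chartAt E x ∈ smoothCharts E M :=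
  IsManifold.chart_mem_maximalAtlas x

end Charts

/-! ### Algebra of one-sided translations. -/

section Translations

variable {G : Type*} [Group G]

theorem Side.translate_inv_translate (S : Side) (h x : G) :
    S.translate h⁻¹ (S.translate h x) = x := by
  cases S <;> simp [Side.translate]

theorem Side.translate_translate_inv (S : Side) (h x : G) :
    S.translate h (S.translate h⁻¹ x) = x := by
  cases S <;> simp [Side.translate]

theorem Side.translate_one (S : Side) (h : G) : S.translate h 1 = h := by
  cases S <;> simp [Side.translate]

theorem Side.one_translate (S : Side) (x : G) : S.translate 1 x = x := by
  cases S <;> simp [Side.translate]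

theorem Side.translate_inv_self (S : Side) (h : G) : S.translate h⁻¹ h = 1 := by
  cases S <;> simp [Side.translate]

/-- This cancellation is the source of the invariance of the Maurer–Cartan form, hence of the
reduced velocity. -/
theorem Side.translate_inv_translate_translate (S : Side) (h x y : G) :
    S.translate (S.translate h x)⁻¹ (S.translate h y) = S.translate x⁻¹ y := by
  cases S <;> simp [Side.translate, mul_assoc]

end Translations

/-! ### The Maurer–Cartan form and the invariant frame in the chart at the identity. -/

section LieGroupChart

variable {E : Type*} [NormedAddCommGroup E] [NormedSpace ℝ E]
variable {X : Type*} [NormedAddCommGroup X] [NormedSpace ℝ X]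
variable {G : Type*} [TopologicalSpace G] [ChartedSpace E G] [Group G]

theorem contMDiffAt_translate [LieGroup 𝓘(ℝ, E) ∞ G] (S : Side) {n : ℕ∞} {a b : X → G} {x : X}
    (ha : ContMDiffAt 𝓘(ℝ, X) 𝓘(ℝ, E) n a x) (hb : ContMDiffAt 𝓘(ℝ, X) 𝓘(ℝ, E) n b x) :
    ContMDiffAt 𝓘(ℝ, X) 𝓘(ℝ, E) n (fun y => S.translate (a y) (b y)) x := by
  have : LieGroup 𝓘(ℝ, E) n G := LieGroup.of_le (n := ∞) (by exact_mod_cast le_top)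
  cases S
  · exact hb.mul ha
  · exact ha.mul hb

theorem contMDiffAt_translate_inv [LieGroup 𝓘(ℝ, E) ∞ G] (S : Side) {n : ℕ∞} {a b : X → G} {x : X}
    (ha : ContMDiffAt 𝓘(ℝ, X) 𝓘(ℝ, E) n a x) (hb : ContMDiffAt 𝓘(ℝ, X) 𝓘(ℝ, E) n b x) :
    ContMDiffAt 𝓘(ℝ, X) 𝓘(ℝ, E) n (fun y => S.translate (a y)⁻¹ (b y)) x := by
  have : LieGroup 𝓘(ℝ, E) n G := LieGroup.of_le (n := ∞) (by exact_mod_cast le_top)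
  exact contMDiffAt_translate S ha.inv hb

variable (E G) in
/-- The preferred chart at the identity. -/
def unitChart : OpenPartialHomeomorph G E := chartAt E (1 : G)

theorem one_mem_unitChart_source : (1 : G) ∈ (unitChart E G).source := mem_chart_source E 1

variable (E G) in
/-- The coordinates of the identity. -/
def unitPoint : E := unitChart E G 1

theorem unitPoint_mem_target : unitPoint E G ∈ (unitChart E G).target :=
  (unitChart E G).map_source one_mem_unitChart_source

theorem unitChart_symm_unitPoint : (unitChart E G).symm (unitPoint E G) = 1 :=
  (unitChart E G).left_inv one_mem_unitChart_source

theorem unitChart_mem [LieGroup 𝓘(ℝ, E) ∞ G] : unitChart E G ∈ smoothCharts E G :=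
  chartAt_mem_smoothCharts 1

variable (G) in
/-- The quotient `y x⁻¹` (resp. `x⁻¹ y`) in the chart at the identity. -/
def chartDiff (S : Side) (x y : E) : E :=
  unitChart E G (S.translate ((unitChart E G).symm x)⁻¹ ((unitChart E G).symm y))

variable (G) in
/-- The product `y x` (resp. `x y`) in the chart at the identity. -/
def chartMul (S : Side) (x y : E) : E :=
  unitChart E G (S.translate ((unitChart E G).symm x) ((unitChart E G).symm y))

variable (G) in
/-- The right (resp. left) invariant Maurer-Cartan form in the chart at the identity. -/
def mcForm (S : Side) (x : E) : E →L[ℝ] E := fderiv ℝ (chartDiff G S x) x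

variable (G) in
/-- The right (resp. left) invariant frame in the chart at the identity. -/
def mcFrame (S : Side) (x : E) : E →L[ℝ] E := fderiv ℝ (chartMul G S x) (unitPoint E G)

theorem chartDiff_unitPoint (S : Side) {y : E} (hy : y ∈ (unitChart E G).target) :
    chartDiff G S (unitPoint E G) y = y := by
  rw [chartDiff, unitChart_symm_unitPoint, inv_one, S.one_translate, (unitChart E G).right_inv hy]

theorem chartMul_unitPoint (S : Side) {y : E} (hy : y ∈ (unitChart E G).target) :
    chartMul G S (unitPoint E G) y = y := by
  rw [chartMul, unitChart_symm_unitPoint, S.one_translate, (unitChart E G).right_inv hy]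

theorem chartDiff_self (S : Side) (x : E) : chartDiff G S x x = unitPoint E G := by
  rw [chartDiff, S.translate_inv_self, unitPoint]

theorem chartMul_unitPoint_right (S : Side) {x : E} (hx : x ∈ (unitChart E G).target) :
    chartMul G S x (unitPoint E G) = x := by
  rw [chartMul, unitChart_symm_unitPoint, S.translate_one, (unitChart E G).right_inv hx]

variable [LieGroup 𝓘(ℝ, E) ∞ G]

theorem contDiffAt_chartDiff (S : Side) {x : E} (hx : x ∈ (unitChart E G).target) :
    ContDiffAt ℝ ∞ (fun q : E × E => chartDiff G S q.1 q.2) (x, x) := by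
  refine contDiffAt_chart_comp (n := ⊤) unitChart_mem (contMDiffAt_translate_inv S
    (contMDiffAt_chart_symm_comp unitChart_mem contDiffAt_fst hx)
    (contMDiffAt_chart_symm_comp unitChart_mem contDiffAt_snd hx)) ?_
  rw [S.translate_inv_self]
  exact one_mem_unitChart_source

theorem contDiffAt_chartMul (S : Side) {x : E} (hx : x ∈ (unitChart E G).target) :
    ContDiffAt ℝ ∞ (fun q : E × E => chartMul G S q.1 q.2) (x, unitPoint E G) := by
  refine contDiffAt_chart_comp (n := ⊤) unitChart_mem (contMDiffAt_translate S
    (contMDiffAt_chart_symm_comp unitChart_mem contDiffAt_fst hx)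
    (contMDiffAt_chart_symm_comp unitChart_mem contDiffAt_snd unitPoint_mem_target)) ?_
  rw [unitChart_symm_unitPoint, S.translate_one]
  exact (unitChart E G).map_target hx

theorem contDiffAt_mcForm (S : Side) {x : E} (hx : x ∈ (unitChart E G).target) :
    ContDiffAt ℝ ∞ (mcForm G S) x :=
  ContDiffAt.fderiv (f := chartDiff G S) (contDiffAt_chartDiff S hx) contDiffAt_id le_rfl

theorem contDiffAt_mcFrame (S : Side) {x : E} (hx : x ∈ (unitChart E G).target) :
    ContDiffAt ℝ ∞ (mcFrame G S) x :=
  ContDiffAt.fderiv (f := chartMul G S) (contDiffAt_chartMul S hx) contDiffAt_const le_rfl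

theorem hasFDerivAt_chartDiff (S : Side) {x : E} (hx : x ∈ (unitChart E G).target) :
    HasFDerivAt (chartDiff G S x) (mcForm G S x) x := by
  have h : ContDiffAt ℝ ∞ (fun y => chartDiff G S x y) x :=
    ContDiffAt.comp (f := fun y : E => (x, y)) x (contDiffAt_chartDiff S hx) (by fun_prop)
  exact (h.differentiableAt (by simp)).hasFDerivAt

theorem hasFDerivAt_chartMul (S : Side) {x : E} (hx : x ∈ (unitChart E G).target) :
    HasFDerivAt (chartMul G S x) (mcFrame G S x) (unitPoint E G) := by
  have h : ContDiffAt ℝ ∞ (fun y => chartMul G S x y) (unitPoint E G) :=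
    ContDiffAt.comp (f := fun y : E => (x, y)) (unitPoint E G) (contDiffAt_chartMul S hx)
      (by fun_prop)
  exact (h.differentiableAt (by simp)).hasFDerivAt

theorem mcForm_unitPoint (S : Side) : mcForm G S (unitPoint E G) = ContinuousLinearMap.id ℝ E := by
  refine (hasFDerivAt_chartDiff S unitPoint_mem_target).unique
    ((hasFDerivAt_id _).congr_of_eventuallyEq ?_)
  filter_upwards [(unitChart E G).open_target.mem_nhds unitPoint_mem_target] with y hy
  exact chartDiff_unitPoint S hy

theorem mcFrame_unitPoint (S : Side) :
    mcFrame G S (unitPoint E G) = ContinuousLinearMap.id ℝ E := by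
  refine (hasFDerivAt_chartMul S unitPoint_mem_target).unique
    ((hasFDerivAt_id _).congr_of_eventuallyEq ?_)
  filter_upwards [(unitChart E G).open_target.mem_nhds unitPoint_mem_target] with y hy
  exact chartMul_unitPoint S hy

/-- Translation by `x` and translation by its inverse undo each other; this is the derivative of
that identity at the unit. The theorem after this one differentiates the opposite composite. -/
theorem mcForm_comp_mcFrame (S : Side) {x : E} (hx : x ∈ (unitChart E G).target) :
    (mcForm G S x).comp (mcFrame G S x) = ContinuousLinearMap.id ℝ E := by
  have h1 := hasFDerivAt_chartMul S hx
  have h2 : HasFDerivAt (chartDiff G S x) (mcForm G S x) (chartMul G S x (unitPoint E G)) := by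
    rw [chartMul_unitPoint_right S hx]
    exact hasFDerivAt_chartDiff S hx
  refine (h2.comp _ h1).unique ((hasFDerivAt_id _).congr_of_eventuallyEq ?_)
  have hc : ContinuousAt (fun y => S.translate ((unitChart E G).symm x) ((unitChart E G).symm y))
      (unitPoint E G) :=
    (contMDiffAt_translate (n := ⊤) S contMDiffAt_const
      (contMDiffAt_chart_symm unitChart_mem unitPoint_mem_target)).continuousAt
  filter_upwards [(unitChart E G).open_target.mem_nhds unitPoint_mem_target,
    hc.preimage_mem_nhds ((unitChart E G).open_source.mem_nhds (by
      rw [unitChart_symm_unitPoint, S.translate_one]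
      exact (unitChart E G).map_target hx))] with y hy hy'
  simp only [Function.comp_apply, chartDiff, chartMul]
  rw [(unitChart E G).left_inv hy', S.translate_inv_translate, (unitChart E G).right_inv hy, id]

theorem mcFrame_comp_mcForm (S : Side) {x : E} (hx : x ∈ (unitChart E G).target) :
    (mcFrame G S x).comp (mcForm G S x) = ContinuousLinearMap.id ℝ E := by
  have h1 := hasFDerivAt_chartDiff S hx
  have h2 : HasFDerivAt (chartMul G S x) (mcFrame G S x) (chartDiff G S x x) := by
    rw [chartDiff_self S]
    exact hasFDerivAt_chartMul S hx
  refine (h2.comp _ h1).unique ((hasFDerivAt_id _).congr_of_eventuallyEq ?_)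
  have hc : ContinuousAt (fun y => S.translate ((unitChart E G).symm x)⁻¹ ((unitChart E G).symm y))
      x :=
    (contMDiffAt_translate (n := ⊤) S contMDiffAt_const
      (contMDiffAt_chart_symm unitChart_mem hx)).continuousAt
  filter_upwards [(unitChart E G).open_target.mem_nhds hx,
    hc.preimage_mem_nhds ((unitChart E G).open_source.mem_nhds (by
      rw [S.translate_inv_self]
      exact one_mem_unitChart_source))] with y hy hy'
  simp only [Function.comp_apply, chartDiff, chartMul]
  rw [(unitChart E G).left_inv hy', S.translate_translate_inv, (unitChart E G).right_inv hy, id]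

theorem hasFDerivAt_chartAt_comp {M : Type*} [TopologicalSpace M] [ChartedSpace E M]
    {f : X → M} {x : X} (hf : MDifferentiableAt 𝓘(ℝ, X) 𝓘(ℝ, E) f x) :
    HasFDerivAt (fun y => chartAt E (f x) (f y))
      (show X →L[ℝ] E from mfderiv 𝓘(ℝ, X) 𝓘(ℝ, E) f x) x := by
  have h := hf.hasMFDerivAt.2
  exact h.hasFDerivAt (by simp)

/-- The reduced velocity, computed in the chart at the identity. -/
theorem reducedCurve_eq_deriv (S : Side) {c : ℝ → G} {t : ℝ}
    (hc : MDifferentiableAt 𝓘(ℝ, ℝ) 𝓘(ℝ, E) c t) :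
    reducedCurve E S c t = deriv (fun s => unitChart E G (S.translate (c t)⁻¹ (c s))) t := by
  have h1 : MDifferentiableAt 𝓘(ℝ, E) 𝓘(ℝ, E) (S.translate (c t)⁻¹) (c t) :=
    (S.contMDiff_translate _).mdifferentiableAt (by simp)
  have h2 := mfderiv_comp_apply t h1 hc (1 : ℝ)
  have h3 : MDifferentiableAt 𝓘(ℝ, ℝ) 𝓘(ℝ, E) (S.translate (c t)⁻¹ ∘ c) t := h1.comp t hc
  have h4 := hasFDerivAt_chartAt_comp h3
  simp only [Function.comp_apply, S.translate_inv_self] at h4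
  exact h2.symm.trans h4.hasDerivAt.deriv.symm

/-- The reduced velocity in terms of the Maurer-Cartan form in the chart at the identity. -/
theorem reducedCurve_eq_mcForm (S : Side) {c : ℝ → G} {t : ℝ} (h : G)
    (hc : MDifferentiableAt 𝓘(ℝ, ℝ) 𝓘(ℝ, E) c t)
    (hs : S.translate h⁻¹ (c t) ∈ (unitChart E G).source) :
    reducedCurve E S c t =
      mcForm G S (unitChart E G (S.translate h⁻¹ (c t)))
        (deriv (fun s => unitChart E G (S.translate h⁻¹ (c s))) t) := by
  have h1 : MDifferentiableAt 𝓘(ℝ, ℝ) 𝓘(ℝ, E) (fun s => S.translate h⁻¹ (c s)) t :=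
    ((S.contMDiff_translate h⁻¹).mdifferentiableAt (by simp)).comp t hc
  have h2 : MDifferentiableAt 𝓘(ℝ, ℝ) 𝓘(ℝ, E) (fun s => unitChart E G (S.translate h⁻¹ (c s))) t :=
    MDifferentiableAt.comp (f := fun s => S.translate h⁻¹ (c s)) t
      ((contMDiffAt_chart unitChart_mem hs).mdifferentiableAt (by simp)) h1
  have h3 := h2.differentiableAt.hasDerivAt
  have ht := (unitChart E G).map_source hs
  have h4 := (hasFDerivAt_chartDiff S ht).comp_hasDerivAt t h3
  rw [reducedCurve_eq_deriv S hc, ← h4.deriv]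
  -- Translating both arguments of the group quotient by the same `h⁻¹` does not change it, so `h`
  -- may be chosen freely to bring the curve into the chart.
  refine Filter.EventuallyEq.deriv_eq ?_
  filter_upwards [h1.continuousAt.preimage_mem_nhds ((unitChart E G).open_source.mem_nhds hs)]
    with s hs'
  simp only [Function.comp_apply, chartDiff]
  rw [(unitChart E G).left_inv hs, (unitChart E G).left_inv hs',
    S.translate_inv_translate_translate]

end LieGroupChart

/-! ### The Maurer–Cartan equation and the bracket. -/

section MaurerCartan

variable {E : Type*} [NormedAddCommGroup E] [NormedSpace ℝ E]
variable {F : Type*} [NormedAddCommGroup F] [NormedSpace ℝ F]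

theorem fderiv_fderiv_right {f : E × E → F} {x₀ y₀ : E} (hf : ContDiffAt ℝ ∞ f (x₀, y₀)) (a b : E) :
    fderiv ℝ (fun x => fderiv ℝ (fun y => f (x, y)) y₀) x₀ a b =
      fderiv ℝ (fderiv ℝ f) (x₀, y₀) (a, 0) (0, b) := by
  have hd : DifferentiableAt ℝ (fderiv ℝ f) (x₀, y₀) :=
    (hf.fderiv_right (m := ∞) le_rfl).differentiableAt (by simp)
  have hc : ContinuousAt (fun x : E => (x, y₀)) x₀ := by fun_prop
  have e : (fun x => fderiv ℝ (fun y => f (x, y)) y₀) =ᶠ[𝓝 x₀]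
      fun x => (fderiv ℝ f (x, y₀)).comp (ContinuousLinearMap.inr ℝ E E) := by
    filter_upwards [hc.eventually (eventually_contDiffAt hf 1)] with x hx
    have h1 : HasFDerivAt f (fderiv ℝ f (x, y₀)) (x, y₀) :=
      (hx.differentiableAt (by simp)).hasFDerivAt
    exact (h1.comp y₀ (hasFDerivAt_prodMk_right x y₀)).fderiv
  rw [e.fderiv_eq]
  have h2 : HasFDerivAt (fun x => fderiv ℝ f (x, y₀))
      ((fderiv ℝ (fderiv ℝ f) (x₀, y₀)).comp (ContinuousLinearMap.inl ℝ E E)) x₀ :=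
    hd.hasFDerivAt.comp x₀ (hasFDerivAt_prodMk_left x₀ y₀)
  rw [(h2.clm_comp (hasFDerivAt_const (ContinuousLinearMap.inr ℝ E E) x₀)).fderiv]
  simp

theorem fderiv_fderiv_left {f : E × E → F} {x₀ y₀ : E} (hf : ContDiffAt ℝ ∞ f (x₀, y₀)) (a b : E) :
    fderiv ℝ (fun y => fderiv ℝ (fun x => f (x, y)) x₀) y₀ a b =
      fderiv ℝ (fderiv ℝ f) (x₀, y₀) (0, a) (b, 0) := by
  have hd : DifferentiableAt ℝ (fderiv ℝ f) (x₀, y₀) :=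
    (hf.fderiv_right (m := ∞) le_rfl).differentiableAt (by simp)
  have hc : ContinuousAt (fun y : E => (x₀, y)) y₀ := by fun_prop
  have e : (fun y => fderiv ℝ (fun x => f (x, y)) x₀) =ᶠ[𝓝 y₀]
      fun y => (fderiv ℝ f (x₀, y)).comp (ContinuousLinearMap.inl ℝ E E) := by
    filter_upwards [hc.eventually (eventually_contDiffAt hf 1)] with y hy
    have h1 : HasFDerivAt f (fderiv ℝ f (x₀, y)) (x₀, y) :=
      (hy.differentiableAt (by simp)).hasFDerivAt
    exact (h1.comp x₀ (hasFDerivAt_prodMk_left x₀ y)).fderiv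
  rw [e.fderiv_eq]
  have h2 : HasFDerivAt (fun y => fderiv ℝ f (x₀, y))
      ((fderiv ℝ (fderiv ℝ f) (x₀, y₀)).comp (ContinuousLinearMap.inr ℝ E E)) y₀ :=
    hd.hasFDerivAt.comp y₀ (hasFDerivAt_prodMk_right x₀ y₀)
  rw [(h2.clm_comp (hasFDerivAt_const (ContinuousLinearMap.inl ℝ E E) y₀)).fderiv]
  simp

/-- This is the exterior derivative of the one-form `C` pulled back by `u`: in the antisymmetrized
expression the mixed second derivatives of `u` cancel, leaving only derivatives of `C`. -/
theorem deriv_form_sub {u : ℝ × ℝ → E} {C : E → E →L[ℝ] F} {z : ℝ × ℝ} (hu : ContDiffAt ℝ ∞ u z)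
    (hC : ContDiffAt ℝ ∞ C (u z)) :
    deriv (fun ε => C (u (ε, z.2)) (deriv (fun t => u (ε, t)) z.2)) z.1 -
      deriv (fun t => C (u (z.1, t)) (deriv (fun ε => u (ε, t)) z.1)) z.2 =
    fderiv ℝ C (u z) (deriv (fun ε => u (ε, z.2)) z.1) (deriv (fun t => u (z.1, t)) z.2) -
      fderiv ℝ C (u z) (deriv (fun t => u (z.1, t)) z.2) (deriv (fun ε => u (ε, z.2)) z.1) := by
  have hC' : HasFDerivAt C (fderiv ℝ C (u z)) (u z) :=
    (hC.differentiableAt (by simp)).hasFDerivAt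
  have du : DifferentiableAt ℝ u z := hu.differentiableAt (by simp)
  have u1 : HasDerivAt (fun ε => u (ε, z.2)) (deriv (fun ε => u (ε, z.2)) z.1) z.1 :=
    (hasDerivAt_comp_mk_left du).differentiableAt.hasDerivAt
  have u2 : HasDerivAt (fun t => u (z.1, t)) (deriv (fun t => u (z.1, t)) z.2) z.2 :=
    (hasDerivAt_comp_mk_right du).differentiableAt.hasDerivAt
  have d1 : HasDerivAt (fun ε => deriv (fun t => u (ε, t)) z.2)
      (deriv (fun ε => deriv (fun t => u (ε, t)) z.2) z.1) z.1 :=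
    (hasDerivAt_comp_mk_left
      ((contDiffAt_deriv_right hu).differentiableAt (by simp))).differentiableAt.hasDerivAt
  have d2 : HasDerivAt (fun t => deriv (fun ε => u (ε, t)) z.1)
      (deriv (fun t => deriv (fun ε => u (ε, t)) z.1) z.2) z.2 :=
    (hasDerivAt_comp_mk_right
      ((contDiffAt_deriv_left hu).differentiableAt (by simp))).differentiableAt.hasDerivAt
  have hX : HasDerivAt (fun ε => C (u (ε, z.2))) (fderiv ℝ C (u z) (deriv (fun ε => u (ε, z.2)) z.1))
      z.1 := hC'.comp_hasDerivAt z.1 u1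
  have hY : HasDerivAt (fun t => C (u (z.1, t))) (fderiv ℝ C (u z) (deriv (fun t => u (z.1, t)) z.2))
      z.2 := hC'.comp_hasDerivAt z.2 u2
  rw [(hX.clm_apply d1).deriv, (hY.clm_apply d2).deriv,
    deriv_deriv_swap (eventually_contDiffAt hu 2).self_of_nhds]
  abel

variable {G : Type*} [TopologicalSpace G] [ChartedSpace E G] [Group G] [LieGroup 𝓘(ℝ, E) ∞ G]

/-- Differentiate form ∘ frame = id at the unit, where both factors are the identity. -/
theorem fderiv_mcForm (S : Side) (a b : E) :
    fderiv ℝ (mcForm G S) (unitPoint E G) a b = -fderiv ℝ (mcFrame G S) (unitPoint E G) a b := by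
  have hp := unitPoint_mem_target (E := E) (G := G)
  have h1 := ((contDiffAt_mcForm S hp).differentiableAt (by simp)).hasFDerivAt
  have h2 := ((contDiffAt_mcFrame S hp).differentiableAt (by simp)).hasFDerivAt
  have h3 := (h1.clm_comp h2).unique ((hasFDerivAt_const
    (ContinuousLinearMap.id ℝ E) (unitPoint E G)).congr_of_eventuallyEq (by
      filter_upwards [(unitChart E G).open_target.mem_nhds hp] with x hx
      exact mcForm_comp_mcFrame S hx))
  have h4 := congr($h3 a b)
  simp only [mcForm_unitPoint, mcFrame_unitPoint] at h4
  simp at h4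
  exact eq_neg_of_add_eq_zero_right h4

/-- The two frames are the two partial derivatives of the same product map, with the roles of the
factors exchanged, so symmetry of its second derivative exchanges the arguments. This is what makes
the sign differ between the two sides. -/
theorem fderiv_mcFrame_right (a b : E) :
    fderiv ℝ (mcFrame G .right) (unitPoint E G) a b =
      fderiv ℝ (mcFrame G .left) (unitPoint E G) b a := by
  have hm := contDiffAt_chartMul (G := G) .left (unitPoint_mem_target (E := E))
  have h1 := fderiv_fderiv_left hm a b
  have h2 := fderiv_fderiv_right hm b a
  have h3 := ((eventually_contDiffAt hm 2).self_of_nhds.isSymmSndFDerivAt (by simp)).eq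
    (0, a) (b, 0)
  exact h1.trans (h3.trans h2.symm)

/-- Identifies the coordinate expression of a left-invariant field with the left frame, so that the
bracket of the Lie algebra becomes a derivative of the frame. -/
theorem mulInvariantVectorField_chart [CompleteSpace E] (v : E) {x : E} (hx : x ∈ (unitChart E G).target) :
    VectorField.mpullbackWithin 𝓘(ℝ, E) 𝓘(ℝ, E) (extChartAt 𝓘(ℝ, E) (1 : G)).symm
      (mulInvariantVectorField (I := 𝓘(ℝ, E)) (G := G) v) (range 𝓘(ℝ, E)) x = mcFrame G .left x v := by
  have hx' : x ∈ (extChartAt 𝓘(ℝ, E) (1 : G)).target := by simpa [unitChart] using hx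
  -- The pullback inverts the derivative of the inverse chart; its inverse is the derivative of the
  -- chart, and the chain rule turns the result into the derivative of a product in coordinates.
  have c1 := mfderiv_extChartAt_comp_mfderivWithin_extChartAt_symm hx'
  have c2 := mfderivWithin_extChartAt_symm_comp_mfderiv_extChartAt hx'
  rw [VectorField.mpullbackWithin_apply, ContinuousLinearMap.inverse_eq c2 c1]
  have m1 : MDifferentiableAt 𝓘(ℝ, E) 𝓘(ℝ, E) (fun y : G => (extChartAt 𝓘(ℝ, E) (1 : G)).symm x * y) 1 :=
    contMDiff_mul_left.contMDiffAt.mdifferentiableAt (n := ∞) (by simp)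
  have hs : (unitChart E G).symm x ∈ (unitChart E G).source := (unitChart E G).map_target hx
  have m2 : MDifferentiableAt 𝓘(ℝ, E) 𝓘(ℝ, E) (extChartAt 𝓘(ℝ, E) (1 : G))
      ((extChartAt 𝓘(ℝ, E) (1 : G)).symm x) :=
    (contMDiffAt_chart unitChart_mem hs).mdifferentiableAt (by simp)
  have m3 := mfderiv_comp_apply_of_eq (1 : G) m2 m1 (by simp) v
  refine m3.symm.trans ?_
  have m4 : HasFDerivAt (chartMul G .left x) (show E →L[ℝ] E from
      mfderiv 𝓘(ℝ, E) 𝓘(ℝ, E) ((extChartAt 𝓘(ℝ, E) (1 : G)) ∘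
        fun y : G => (extChartAt 𝓘(ℝ, E) (1 : G)).symm x * y) 1) (unitPoint E G) :=
    (m2.comp_of_eq 1 m1 (by simp)).hasMFDerivAt.2.hasFDerivAt (by simp)
  have m5 := m4.unique (hasFDerivAt_chartMul (G := G) .left hx)
  exact congr($m5 v)

/-- The Lie bracket of two coordinate vector fields is Df·V-type minus its transpose; at the unit
the left-invariant fields take the values `a` and `b`, which gives the antisymmetrized derivative of
the frame. -/
theorem bracket_eq_fderiv_mcFrame [CompleteSpace E] (a b : E) :
    bracket G a b = fderiv ℝ (mcFrame G .left) (unitPoint E G) a b -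
      fderiv ℝ (mcFrame G .left) (unitPoint E G) b a := by
  have hp := unitPoint_mem_target (E := E) (G := G)
  have hV : ∀ v : E, VectorField.mpullbackWithin 𝓘(ℝ, E) 𝓘(ℝ, E) (extChartAt 𝓘(ℝ, E) (1 : G)).symm
      (mulInvariantVectorField (I := 𝓘(ℝ, E)) (G := G) v) (range 𝓘(ℝ, E)) =ᶠ[𝓝 (unitPoint E G)]
        fun x => mcFrame G .left x v := by
    intro v
    filter_upwards [(unitChart E G).open_target.mem_nhds hp] with x hx
    exact mulInvariantVectorField_chart v hx
  have hd := (contDiffAt_mcFrame (G := G) .left hp).differentiableAt (by simp)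
  have hL : VectorField.lieBracket ℝ
      (fun x => mcFrame G .left x a) (fun x => mcFrame G .left x b) (unitPoint E G) =
      fderiv ℝ (mcFrame G .left) (unitPoint E G) a b -
      fderiv ℝ (mcFrame G .left) (unitPoint E G) b a := by
    have hd' : ∀ v w, fderiv ℝ (fun x => mcFrame G .left x v) (unitPoint E G) w =
        fderiv ℝ (mcFrame G .left) (unitPoint E G) w v := fun v w => by
      rw [(hd.hasFDerivAt.clm_apply (hasFDerivAt_const v _)).fderiv]
      simp
    rw [VectorField.lieBracket, hd', hd', mcFrame_unitPoint]
    rfl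
  rw [← hL, ← (hV a).lieBracket_vectorField_eq (hV b)]
  -- The tangent space at 1 is itself trivialized by the preferred chart there, so the derivative of
  -- that chart at 1 is the identity and the final pullback changes nothing.
  have hid : (show E →L[ℝ] E from mfderiv 𝓘(ℝ, E) 𝓘(ℝ, E) (extChartAt 𝓘(ℝ, E) (1 : G)) 1) =
      ContinuousLinearMap.id ℝ E := by
    have h0 : MDifferentiableAt 𝓘(ℝ, E) 𝓘(ℝ, E) (extChartAt 𝓘(ℝ, E) (1 : G)) 1 :=
      (contMDiffAt_chart unitChart_mem one_mem_unitChart_source).mdifferentiableAt (by simp)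
    have h1 : HasFDerivAt (fun x => unitChart E G ((unitChart E G).symm x))
        (show E →L[ℝ] E from mfderiv 𝓘(ℝ, E) 𝓘(ℝ, E) (extChartAt 𝓘(ℝ, E) (1 : G)) 1)
        (unitPoint E G) :=
      h0.hasMFDerivAt.2.hasFDerivAt (by simp)
    refine h1.unique ((hasFDerivAt_id _).congr_of_eventuallyEq ?_)
    filter_upwards [(unitChart E G).open_target.mem_nhds hp] with x hx
    exact (unitChart E G).right_inv hx
  have hinv : ∀ v : E, (show E →L[ℝ] E from
      mfderiv 𝓘(ℝ, E) 𝓘(ℝ, E) (extChartAt 𝓘(ℝ, E) (1 : G)) 1).inverse v = v := by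
    intro v
    rw [hid, ContinuousLinearMap.inverse_id]
    rfl
  refine (VectorField.mlieBracketWithin_apply (I := 𝓘(ℝ, E)) (s := univ) (x₀ := (1 : G))).trans ?_
  refine (hinv _).trans ?_
  rw [preimage_univ, univ_inter, ModelWithCorners.range_eq_univ]
  exact congrFun VectorField.lieBracketWithin_univ _

theorem bracket_swap [CompleteSpace E] (a b : E) : bracket G a b = -bracket G b a := by
  rw [bracket_eq_fderiv_mcFrame, bracket_eq_fderiv_mcFrame, neg_sub]

theorem contDiffAt_bracket [CompleteSpace E] {X : Type*} [NormedAddCommGroup X] [NormedSpace ℝ X]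
    {f g : X → E} {x : X} (hf : ContDiffAt ℝ ∞ f x) (hg : ContDiffAt ℝ ∞ g x) :
    ContDiffAt ℝ ∞ (fun y => bracket G (f y) (g y)) x := by
  simp only [bracket_eq_fderiv_mcFrame]
  fun_prop

/-- The Maurer-Cartan equation at the identity. -/
theorem fderiv_mcForm_sub [CompleteSpace E] (S : Side) (a b : E) :
    fderiv ℝ (mcForm G S) (unitPoint E G) a b - fderiv ℝ (mcForm G S) (unitPoint E G) b a =
      S.sign • bracket G a b := by
  rw [fderiv_mcForm, fderiv_mcForm, bracket_eq_fderiv_mcFrame]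
  -- The minus sign from `fderiv_mcForm` remains on the left; on the right it is absorbed by the
  -- exchange of arguments.
  cases S
  · rw [fderiv_mcFrame_right, fderiv_mcFrame_right, Side.sign, one_smul]
    abel
  · rw [Side.sign, neg_one_smul]
    abel

/-- The order is a natural number because being C^m at a point passes to nearby points when m is
finite, whereas being smooth at a point need not. -/
theorem eventually_contMDiffAt {X : Type*} [NormedAddCommGroup X] [NormedSpace ℝ X]
    {M : Type*} [TopologicalSpace M] [ChartedSpace E M] [IsManifold 𝓘(ℝ, E) ∞ M] {f : X → M} {x : X}
    {m : ℕ} (hf : ContMDiffAt 𝓘(ℝ, X) 𝓘(ℝ, E) (m : ℕ∞) f x) :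
    ∀ᶠ y in 𝓝 x, ContMDiffAt 𝓘(ℝ, X) 𝓘(ℝ, E) (m : ℕ∞) f y := by
  have h1 : ContDiffAt ℝ m (fun y => chartAt E (f x) (f y)) x := by
    exact_mod_cast contDiffAt_chart_comp (chartAt_mem_smoothCharts _) hf (mem_chart_source E _)
  have h2 := (chartAt E (f x)).open_source.mem_nhds (mem_chart_source E (f x))
  filter_upwards [h1.eventually (by simp),
    (hf.continuousAt.preimage_mem_nhds h2), eventually_eventually_nhds.2
    (hf.continuousAt.preimage_mem_nhds h2)] with y hy hys hye
  have h3 := contMDiffAt_chart_symm_comp (n := m) (u := fun w => chartAt E (f x) (f w))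
    (chartAt_mem_smoothCharts (f x)) (by exact_mod_cast hy) ((chartAt E (f x)).map_source hys)
  refine h3.congr_of_eventuallyEq ?_
  filter_upwards [hye] with w hw
  exact ((chartAt E (f x)).left_inv hw).symm

/-! ### Reduced velocities of two-parameter families. -/

section Families

variable (S : Side) {γ : ℝ → ℝ → G} {z : ℝ × ℝ}

/-- Translating by the constant inverse of the value at `z` brings the family near 1, where a single
chart suffices, and does not affect its reduced velocities. -/
theorem contDiffAt_unitChart_translate
    (hγ : ContMDiffAt 𝓘(ℝ, ℝ × ℝ) 𝓘(ℝ, E) ∞ (fun p : ℝ × ℝ => γ p.1 p.2) z) :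
    ContDiffAt ℝ ∞ (fun p : ℝ × ℝ => unitChart E G (S.translate (γ z.1 z.2)⁻¹ (γ p.1 p.2))) z :=
  contDiffAt_chart_comp (n := ⊤) unitChart_mem (contMDiffAt_translate S contMDiffAt_const hγ)
    (by rw [S.translate_inv_self]; exact one_mem_unitChart_source)

theorem eventually_translate_mem
    (hγ : ContMDiffAt 𝓘(ℝ, ℝ × ℝ) 𝓘(ℝ, E) ∞ (fun p : ℝ × ℝ => γ p.1 p.2) z) :
    ∀ᶠ p in 𝓝 z, S.translate (γ z.1 z.2)⁻¹ (γ p.1 p.2) ∈ (unitChart E G).source := by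
  have h1 : ContinuousAt (fun p : ℝ × ℝ => S.translate (γ z.1 z.2)⁻¹ (γ p.1 p.2)) z :=
    (contMDiffAt_translate (n := ⊤) S contMDiffAt_const hγ).continuousAt
  exact h1.preimage_mem_nhds ((unitChart E G).open_source.mem_nhds (by
    rw [S.translate_inv_self]; exact one_mem_unitChart_source))

theorem eventually_reducedCurve_eq
    (hγ : ContMDiffAt 𝓘(ℝ, ℝ × ℝ) 𝓘(ℝ, E) ∞ (fun p : ℝ × ℝ => γ p.1 p.2) z) :
    ∀ᶠ p : ℝ × ℝ in 𝓝 z, reducedCurve E S (γ p.1) p.2 =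
      mcForm G S (unitChart E G (S.translate (γ z.1 z.2)⁻¹ (γ p.1 p.2)))
        (deriv (fun t => unitChart E G (S.translate (γ z.1 z.2)⁻¹ (γ p.1 t))) p.2) := by
  filter_upwards [eventually_contMDiffAt (m := 1) (hγ.of_le (by exact_mod_cast le_top)),
    eventually_translate_mem S hγ] with p hp hs
  refine reducedCurve_eq_mcForm S _ ?_ hs
  have h1 : MDifferentiableAt 𝓘(ℝ, ℝ) 𝓘(ℝ, ℝ × ℝ) (fun t : ℝ => (p.1, t)) p.2 :=
    (show DifferentiableAt ℝ (fun t : ℝ => (p.1, t)) p.2 by fun_prop).mdifferentiableAt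
  exact MDifferentiableAt.comp_of_eq (f := fun t : ℝ => (p.1, t)) (y := p) p.2
    (hp.mdifferentiableAt (by simp)) h1 rfl

theorem eventually_reducedCurve_eq_left
    (hγ : ContMDiffAt 𝓘(ℝ, ℝ × ℝ) 𝓘(ℝ, E) ∞ (fun p : ℝ × ℝ => γ p.1 p.2) z) :
    ∀ᶠ p : ℝ × ℝ in 𝓝 z, reducedCurve E S (fun ε => γ ε p.2) p.1 =
      mcForm G S (unitChart E G (S.translate (γ z.1 z.2)⁻¹ (γ p.1 p.2)))
        (deriv (fun ε => unitChart E G (S.translate (γ z.1 z.2)⁻¹ (γ ε p.2))) p.1) := by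
  filter_upwards [eventually_contMDiffAt (m := 1) (hγ.of_le (by exact_mod_cast le_top)),
    eventually_translate_mem S hγ] with p hp hs
  refine reducedCurve_eq_mcForm S (c := fun ε => γ ε p.2) _ ?_ hs
  have h1 : MDifferentiableAt 𝓘(ℝ, ℝ) 𝓘(ℝ, ℝ × ℝ) (fun ε : ℝ => (ε, p.2)) p.1 :=
    (show DifferentiableAt ℝ (fun ε : ℝ => (ε, p.2)) p.1 by fun_prop).mdifferentiableAt
  exact MDifferentiableAt.comp_of_eq (f := fun ε : ℝ => (ε, p.2)) (y := p) p.1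
    (hp.mdifferentiableAt (by simp)) h1 rfl

theorem mcForm_contDiffAt_comp
    (hγ : ContMDiffAt 𝓘(ℝ, ℝ × ℝ) 𝓘(ℝ, E) ∞ (fun p : ℝ × ℝ => γ p.1 p.2) z) :
    ContDiffAt ℝ ∞ (fun p : ℝ × ℝ =>
      mcForm G S (unitChart E G (S.translate (γ z.1 z.2)⁻¹ (γ p.1 p.2)))) z := by
  have hp := unitPoint_mem_target (E := E) (G := G)
  refine ContDiffAt.fun_comp z (g := mcForm G S) ?_ (contDiffAt_unitChart_translate S hγ)
  rw [S.translate_inv_self]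
  exact contDiffAt_mcForm S hp

theorem contDiffAt_reducedCurve
    (hγ : ContMDiffAt 𝓘(ℝ, ℝ × ℝ) 𝓘(ℝ, E) ∞ (fun p : ℝ × ℝ => γ p.1 p.2) z) :
    ContDiffAt ℝ ∞ (fun p : ℝ × ℝ => reducedCurve E S (γ p.1) p.2) z :=
  ((mcForm_contDiffAt_comp S hγ).clm_apply
    (contDiffAt_deriv_right (contDiffAt_unitChart_translate S hγ))).congr_of_eventuallyEq
      (eventually_reducedCurve_eq S hγ)

theorem contDiffAt_reducedCurve_left
    (hγ : ContMDiffAt 𝓘(ℝ, ℝ × ℝ) 𝓘(ℝ, E) ∞ (fun p : ℝ × ℝ => γ p.1 p.2) z) :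
    ContDiffAt ℝ ∞ (fun p : ℝ × ℝ => reducedCurve E S (fun ε => γ ε p.2) p.1) z :=
  ((mcForm_contDiffAt_comp S hγ).clm_apply
    (contDiffAt_deriv_left (contDiffAt_unitChart_translate S hγ))).congr_of_eventuallyEq
      (eventually_reducedCurve_eq_left S hγ)

/-- The variation of the reduced curve induced by a variation of a curve in the group. -/
theorem deriv_reducedCurve [CompleteSpace E]
    (hγ : ContMDiffAt 𝓘(ℝ, ℝ × ℝ) 𝓘(ℝ, E) ∞ (fun p : ℝ × ℝ => γ p.1 p.2) z) :
    deriv (fun ε => reducedCurve E S (γ ε) z.2) z.1 =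
      deriv (fun t => reducedCurve E S (fun ε => γ ε t) z.1) z.2 -
        S.sign • bracket G (reducedCurve E S (γ z.1) z.2) (reducedCurve E S (fun ε => γ ε z.2) z.1) := by
  have hu := contDiffAt_unitChart_translate S hγ
  have huz : unitChart E G (S.translate (γ z.1 z.2)⁻¹ (γ z.1 z.2)) = unitPoint E G := by
    rw [S.translate_inv_self, unitPoint]
  have eX := eventually_reducedCurve_eq S hγ
  have eY := eventually_reducedCurve_eq_left S hγ
  have hX0 := eX.self_of_nhds
  have hY0 := eY.self_of_nhds
  rw [huz, mcForm_unitPoint, ContinuousLinearMap.id_apply] at hX0 hY0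
  have c1 : Tendsto (fun ε : ℝ => (ε, z.2)) (𝓝 z.1) (𝓝 z) :=
    (show ContinuousAt (fun ε : ℝ => (ε, z.2)) z.1 by fun_prop)
  have c2 : Tendsto (fun t : ℝ => (z.1, t)) (𝓝 z.2) (𝓝 z) :=
    (show ContinuousAt (fun t : ℝ => (z.1, t)) z.2 by fun_prop)
  have key := deriv_form_sub hu (C := mcForm G S) (by
    rw [huz]
    exact contDiffAt_mcForm S unitPoint_mem_target)
  -- At `z` the translated family sits at the unit, where the form is the identity, so its
  -- coordinate velocities are the reduced ones. The swap is needed since the exterior derivative is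
  -- taken on (∂/∂ε, ∂/∂t), which produces [η, ξ].
  rw [huz, fderiv_mcForm_sub, bracket_swap, smul_neg] at key
  rw [← hX0, ← hY0] at key
  have dX : (fun ε => reducedCurve E S (γ ε) z.2) =ᶠ[𝓝 z.1] fun ε =>
      mcForm G S (unitChart E G (S.translate (γ z.1 z.2)⁻¹ (γ ε z.2)))
        (deriv (fun t => unitChart E G (S.translate (γ z.1 z.2)⁻¹ (γ ε t))) z.2) :=
    c1.eventually eX
  have dY : (fun t => reducedCurve E S (fun ε => γ ε t) z.1) =ᶠ[𝓝 z.2] fun t =>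
      mcForm G S (unitChart E G (S.translate (γ z.1 z.2)⁻¹ (γ z.1 t)))
        (deriv (fun ε => unitChart E G (S.translate (γ z.1 z.2)⁻¹ (γ ε t))) z.1) :=
    c2.eventually eY
  rw [dX.deriv_eq, dY.deriv_eq, sub_eq_add_neg, ← key]
  exact (add_sub_cancel _ _).symm

end Families

end MaurerCartan

/-! ### Recovering the jet of a curve from its initial point and the jet of its reduced velocity. -/

section Reconstruction

variable {E : Type*} [NormedAddCommGroup E] [NormedSpace ℝ E]
variable {F : Type*} [NormedAddCommGroup F] [NormedSpace ℝ F]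
variable {F' : Type*} [NormedAddCommGroup F'] [NormedSpace ℝ F']

theorem iteratedDeriv_prodMk {u : ℝ → E} {v : ℝ → F} {t : ℝ} {m : ℕ}
    (hu : ContDiffAt ℝ m u t) (hv : ContDiffAt ℝ m v t) {j : ℕ} (hj : j ≤ m) :
    iteratedDeriv j (fun s => (u s, v s)) t = (iteratedDeriv j u t, iteratedDeriv j v t) := by
  have h := hu.prodMk hv
  have hj' : (j : WithTop ℕ∞) ≤ m := by exact_mod_cast hj
  have h1 := (ContinuousLinearMap.fst ℝ E F).iteratedFDeriv_comp_left h hj'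
  have h2 := (ContinuousLinearMap.snd ℝ E F).iteratedFDeriv_comp_left h hj'
  simp only [iteratedDeriv_eq_iteratedFDeriv]
  ext
  · exact congr($h1 (fun _ => 1)).symm
  · exact congr($h2 (fun _ => 1)).symm

theorem iteratedDeriv_clm_apply_congr {A : E → F →L[ℝ] F'} {u₁ u₂ : ℝ → E} {v₁ v₂ : ℝ → F} {t : ℝ}
    {m : ℕ} (hA : ContDiffAt ℝ ∞ A (u₁ t))
    (hu₁ : ContDiffAt ℝ m u₁ t) (hu₂ : ContDiffAt ℝ m u₂ t)
    (hv₁ : ContDiffAt ℝ m v₁ t) (hv₂ : ContDiffAt ℝ m v₂ t)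
    (hu : ∀ j ≤ m, iteratedDeriv j u₁ t = iteratedDeriv j u₂ t)
    (hv : ∀ j ≤ m, iteratedDeriv j v₁ t = iteratedDeriv j v₂ t) :
    ∀ j ≤ m, iteratedDeriv j (fun s => A (u₁ s) (v₁ s)) t =
      iteratedDeriv j (fun s => A (u₂ s) (v₂ s)) t := by
  refine iteratedDeriv_comp_congr (H := fun p : E × F => A p.1 p.2) (u := fun s => (u₁ s, v₁ s))
    (v := fun s => (u₂ s, v₂ s)) ?_ (hu₁.prodMk hv₁) (hu₂.prodMk hv₂) fun j hj => ?_
  · have h1 : ContDiffAt ℝ m (fun p : E × F => A p.1) (u₁ t, v₁ t) :=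
      ContDiffAt.fun_comp (g := A) _ (hA.of_le (by exact_mod_cast le_top)) contDiffAt_fst
    exact h1.clm_apply contDiffAt_snd
  · rw [iteratedDeriv_prodMk hu₁ hv₁ hj, iteratedDeriv_prodMk hu₂ hv₂ hj, hu j hj, hv j hj]

/-- For solutions of `u' = B(u) v`, the initial value of `u` and the jet of `v` determine the jet
of `u`. -/
theorem iteratedDeriv_eq_of_deriv_eq {B : E → F →L[ℝ] E} {u₁ u₂ : ℝ → E} {v₁ v₂ : ℝ → F} {t : ℝ}
    {n : ℕ} (hB : ContDiffAt ℝ ∞ B (u₁ t))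
    (hu₁ : ContDiffAt ℝ n u₁ t) (hu₂ : ContDiffAt ℝ n u₂ t)
    (hv₁ : ContDiffAt ℝ n v₁ t) (hv₂ : ContDiffAt ℝ n v₂ t)
    (h₁ : deriv u₁ =ᶠ[𝓝 t] fun s => B (u₁ s) (v₁ s))
    (h₂ : deriv u₂ =ᶠ[𝓝 t] fun s => B (u₂ s) (v₂ s))
    (h0 : u₁ t = u₂ t) (hv : ∀ j ≤ n, iteratedDeriv j v₁ t = iteratedDeriv j v₂ t) :
    ∀ j ≤ n + 1, iteratedDeriv j u₁ t = iteratedDeriv j u₂ t := by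
  intro j
  induction j using Nat.strong_induction_on with
  | _ j ih =>
    intro hj
    cases j with
    | zero => simpa using h0
    | succ i =>
      have hi : (i : WithTop ℕ∞) ≤ n := by exact_mod_cast Nat.le_of_succ_le_succ hj
      -- The equation expresses the derivative of order i + 1 of `u` through the `i`-jets of `u` and
      -- `v`, whence a strong induction that gains one order over `v`.
      rw [iteratedDeriv_succ', iteratedDeriv_succ', h₁.iteratedDeriv_eq, h₂.iteratedDeriv_eq]
      exact iteratedDeriv_clm_apply_congr hB (hu₁.of_le hi) (hu₂.of_le hi) (hv₁.of_le hi)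
        (hv₂.of_le hi) (fun l hl => ih l (by omega) (by omega)) (fun l hl => hv l (by omega)) i le_rfl

/-- Formal solutions of `u' = B(u) ζ`, depending smoothly on the jet `ζ`. -/
theorem exists_formal_solution {B : E → F →L[ℝ] E} {p : E} (hB : ContDiffAt ℝ ∞ B p) (k m : ℕ) :
    ∃ Q : (Fin k → F) → ℝ → E,
      (∀ ζ, ContDiffAt ℝ ∞ (fun z : (Fin k → F) × ℝ => Q z.1 z.2) (ζ, 0)) ∧ (∀ ζ, Q ζ 0 = p) ∧
      ∀ ζ, ∀ j < m, iteratedDeriv (j + 1) (Q ζ) 0 =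
        iteratedDeriv j (fun s => B (Q ζ s) (taylorCurve ζ s)) 0 := by
  induction m with
  | zero => exact ⟨fun _ _ => p, fun _ => contDiffAt_const, fun _ => rfl, fun _ j hj => by omega⟩
  | succ m ih =>
    obtain ⟨Q, hQ, hQ0, hQd⟩ := ih
    have hR : ∀ ζ, ContDiffAt ℝ ∞
        (fun z : (Fin k → F) × ℝ => B (Q z.1 z.2) (taylorCurve z.1 z.2)) (ζ, 0) := by
      intro ζ
      refine (ContDiffAt.fun_comp (g := B) (ζ, (0 : ℝ)) ?_ (hQ ζ)).clm_apply
        contDiff_taylorCurve.contDiffAt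
      rwa [hQ0]
    have hslice : ∀ {f : (Fin k → F) × ℝ → E} (ζ : Fin k → F), ContDiffAt ℝ ∞ f (ζ, 0) →
        ContDiffAt ℝ ∞ (fun s => f (ζ, s)) 0 := fun ζ hf =>
      ContDiffAt.fun_comp (f := fun s : ℝ => (ζ, s)) (0 : ℝ) hf (by fun_prop)
    -- Picard iteration on Taylor coefficients: the next approximation starts at `p` and takes its
    -- derivatives at 0 from the right hand side evaluated on the previous one.
    let q : (Fin k → F) → Fin (m + 2) → E := fun ζ =>
      Fin.cons p fun j : Fin (m + 1) => iteratedDeriv j (fun s => B (Q ζ s) (taylorCurve ζ s)) 0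
    have hq : ContDiff ℝ ∞ q := by
      refine contDiff_iff_contDiffAt.2 fun ζ => contDiffAt_pi.2 fun i => ?_
      refine Fin.cases ?_ (fun j => ?_) i
      · simpa only [q, Fin.cons_zero] using contDiffAt_const
      · simp only [q, Fin.cons_succ]
        exact ContDiffAt.fun_comp (f := fun ζ : Fin k → F => (ζ, (0 : ℝ))) ζ
          (contDiffAt_iteratedDeriv_right (hR ζ) j) (by fun_prop)
    have hT : ∀ ζ, ∀ j ≤ m, iteratedDeriv (j + 1) (taylorCurve (q ζ)) 0 =
        iteratedDeriv j (fun s => B (Q ζ s) (taylorCurve ζ s)) 0 := by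
      intro ζ j hj
      have h1 := iteratedDeriv_taylorCurve (q ζ) (Fin.succ ⟨j, Nat.lt_succ_of_le hj⟩)
      simpa only [q, Fin.cons_succ, Fin.val_succ] using h1
    have hT0 : ∀ ζ, taylorCurve (q ζ) 0 = p := fun ζ => by
      rw [taylorCurve_zero]
      simp [q]
    refine ⟨fun ζ => taylorCurve (q ζ), fun ζ => ?_, hT0, fun ζ j hj => ?_⟩
    · exact ContDiffAt.fun_comp (f := fun z : (Fin k → F) × ℝ => (q z.1, z.2)) (ζ, (0 : ℝ))
        contDiff_taylorCurve.contDiffAt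
        ((hq.contDiffAt.comp (ζ, (0 : ℝ)) contDiffAt_fst).prodMk contDiffAt_snd)
    · rw [hT ζ j (by omega)]
      have hle : (m : WithTop ℕ∞) ≤ ∞ := by exact_mod_cast le_top
      -- Old and new approximations agree to order `m` at 0, so replacing one by the other leaves
      -- the right hand side unchanged to order `m`.
      refine iteratedDeriv_clm_apply_congr (m := m) (by rwa [hQ0]) ((hslice ζ (hQ ζ)).of_le hle)
        ((contDiffAt_taylorCurve (q ζ) 0).of_le hle) ((contDiffAt_taylorCurve ζ 0).of_le hle)
        ((contDiffAt_taylorCurve ζ 0).of_le hle) (fun l hl => ?_) (fun _ _ => rfl) j (by omega)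
      cases l with
      | zero => simp [hQ0, hT0]
      | succ l => rw [hT ζ l (by omega), hQd ζ l (by omega)]

end Reconstruction

/-! ### The reduced Lagrangian is well defined and smooth. -/

section ReducedLagrangian

variable {E : Type*} [NormedAddCommGroup E] [NormedSpace ℝ E]
variable {G : Type*} [TopologicalSpace G] [ChartedSpace E G] [Group G] [LieGroup 𝓘(ℝ, E) ∞ G]

theorem contDiffAt_nat_deriv {u : ℝ → E} {t : ℝ} {n : ℕ} (hu : ContDiffAt ℝ (n + 1 : ℕ) u t) :
    ContDiffAt ℝ n (deriv u) t := by
  have h : ContDiffAt ℝ n (fun s => fderiv ℝ u s 1) t :=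
    (hu.fderiv_right (m := n) (by norm_cast)).clm_apply contDiffAt_const
  simpa using h

/-- The dictionary between a curve translated to pass through 1, with coordinates u, and its reduced
velocity ξ: ξ is the form applied to u', and u' is the frame applied to ξ. One order of
differentiability is lost. -/
theorem reducedCurve_chart (S : Side) {n : ℕ} {c : ℝ → G} {t : ℝ}
    (hc : ContMDiffAt 𝓘(ℝ, ℝ) 𝓘(ℝ, E) ((n + 1 : ℕ) : ℕ∞) c t) :
    ContDiffAt ℝ (n + 1 : ℕ) (fun s => unitChart E G (S.translate (c t)⁻¹ (c s))) t ∧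
    (reducedCurve E S c =ᶠ[𝓝 t] fun s => mcForm G S (unitChart E G (S.translate (c t)⁻¹ (c s)))
      (deriv (fun r => unitChart E G (S.translate (c t)⁻¹ (c r))) s)) ∧
    (deriv (fun r => unitChart E G (S.translate (c t)⁻¹ (c r))) =ᶠ[𝓝 t] fun s =>
      mcFrame G S (unitChart E G (S.translate (c t)⁻¹ (c s))) (reducedCurve E S c s)) ∧
    ContDiffAt ℝ n (reducedCurve E S c) t := by
  have hu : ContDiffAt ℝ (n + 1 : ℕ) (fun s => unitChart E G (S.translate (c t)⁻¹ (c s))) t := by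
    refine mod_cast contDiffAt_chart_comp (n := (n + 1 : ℕ)) unitChart_mem
      (contMDiffAt_translate S contMDiffAt_const hc) ?_
    rw [S.translate_inv_self]
    exact one_mem_unitChart_source
  have hs : ∀ᶠ s in 𝓝 t, S.translate (c t)⁻¹ (c s) ∈ (unitChart E G).source := by
    have h1 : ContinuousAt (fun s => S.translate (c t)⁻¹ (c s)) t :=
      (contMDiffAt_translate S contMDiffAt_const hc).continuousAt
    exact h1.preimage_mem_nhds ((unitChart E G).open_source.mem_nhds (by
      rw [S.translate_inv_self]; exact one_mem_unitChart_source))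
  have e1 : reducedCurve E S c =ᶠ[𝓝 t] fun s =>
      mcForm G S (unitChart E G (S.translate (c t)⁻¹ (c s)))
        (deriv (fun r => unitChart E G (S.translate (c t)⁻¹ (c r))) s) := by
    filter_upwards [hs, eventually_contMDiffAt hc] with s hs hcs
    exact reducedCurve_eq_mcForm S _ (hcs.mdifferentiableAt (by simp)) hs
  refine ⟨hu, e1, ?_, ?_⟩
  · filter_upwards [hs, e1] with s hs he
    rw [he]
    exact congr($(mcFrame_comp_mcForm S ((unitChart E G).map_source hs)) _).symm
  · refine ContDiffAt.congr_of_eventuallyEq ?_ e1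
    refine ContDiffAt.clm_apply (ContDiffAt.fun_comp (g := mcForm G S) t ?_
      (hu.of_le (by exact_mod_cast Nat.le_succ n))) (contDiffAt_nat_deriv hu)
    rw [S.translate_inv_self]
    exact (contDiffAt_mcForm S unitPoint_mem_target).of_le (by exact_mod_cast le_top)

/-- Both translated curves start at the unit and solve u' = B(u) ξ with the same (k-1)-jet of ξ, so
they have the same k-jet. -/
theorem jetMk_translate_eq_of_quotientMap_eq (S : Side) {k : ℕ} (hk : 1 ≤ k) {c₁ c₂ : JetCurve E k G}
    (h : quotientMap S c₁ = quotientMap S c₂) :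
    jetMk (c₁.translate S (c₁.1 0)⁻¹) = jetMk (c₂.translate S (c₂.1 0)⁻¹) := by
  obtain ⟨n, rfl⟩ : ∃ n, k = n + 1 := ⟨k - 1, by omega⟩
  obtain ⟨a1, -, a3, a4⟩ := reducedCurve_chart S c₁.2
  obtain ⟨b1, -, b3, b4⟩ := reducedCurve_chart S c₂.2
  have hn : (n : WithTop ℕ∞) ≤ (n + 1 : ℕ) := by exact_mod_cast Nat.le_succ n
  refine jetMk_eq_of_chart unitChart_mem ?_ ?_ ?_
  · change S.translate (c₁.1 0)⁻¹ (c₁.1 0) ∈ _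
    rw [S.translate_inv_self]
    exact one_mem_unitChart_source
  · change S.translate (c₁.1 0)⁻¹ (c₁.1 0) = S.translate (c₂.1 0)⁻¹ (c₂.1 0)
    rw [S.translate_inv_self, S.translate_inv_self]
  · refine iteratedDeriv_eq_of_deriv_eq (B := mcFrame G S) ?_ (a1.of_le hn) (b1.of_le hn) a4 b4 a3 b3
      ?_ fun j hj => congrFun h ⟨j, Nat.lt_succ_of_le hj⟩
    · change ContDiffAt ℝ ∞ (mcFrame G S) (unitChart E G (S.translate (c₁.1 0)⁻¹ (c₁.1 0)))
      rw [S.translate_inv_self]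
      exact contDiffAt_mcFrame S unitPoint_mem_target
    · change unitChart E G (S.translate (c₁.1 0)⁻¹ (c₁.1 0)) =
        unitChart E G (S.translate (c₂.1 0)⁻¹ (c₂.1 0))
      rw [S.translate_inv_self, S.translate_inv_self]

/-- By invariance both jets may be moved to the identity, where they coincide; thus `L` is constant
on the fibres of the quotient map and the extension takes the intended value. -/
theorem reducedLagrangian_quotientMap {S : Side} {k : ℕ} (hk : 1 ≤ k) {L : HigherTangent E k G → ℝ}
    (hinv : IsInvariantLagrangian S L) (c : JetCurve E k G) :
    reducedLagrangian S L (quotientMap S c) = L (jetMk c) := by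
  refine Function.FactorsThrough.extend_apply (fun c₁ c₂ h => ?_) _ _
  rw [← hinv (c₁.1 0)⁻¹ c₁, ← hinv (c₂.1 0)⁻¹ c₂, jetMk_translate_eq_of_quotientMap_eq S hk h]

theorem derivTuple_comp_const_add {n : ℕ} (x : ℝ → E) (t : ℝ) :
    derivTuple n (fun s => x (t + s)) 0 = derivTuple n x t := by
  funext i
  have h := congrFun (iteratedDeriv_comp_const_add i x t) 0
  rw [add_zero] at h
  exact h

theorem lagrangianAlong_eq_reducedLagrangian {S : Side} {k : ℕ} (hk : 1 ≤ k)
    {L : HigherTangent E k G → ℝ} (hinv : IsInvariantLagrangian S L) {c : ℝ → G} {t : ℝ}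
    (hc : ContMDiffAt 𝓘(ℝ, ℝ) 𝓘(ℝ, E) (k : ℕ∞) c t) :
    lagrangianAlong L c t = reducedLagrangian S L (derivTuple k (reducedCurve E S c) t) := by
  refine (lagrangianAlong_of_contMDiffAt L hc).trans
    ((reducedLagrangian_quotientMap hk hinv _).symm.trans (congrArg _ ?_))
  rw [← derivTuple_comp_const_add]
  refine derivTuple_congr ?_
  have hk0 : ((k : ℕ∞) : WithTop ℕ∞) ≠ 0 := by
    have : k ≠ 0 := by omega
    exact_mod_cast this
  have ht : Tendsto (fun s : ℝ => t + s) (𝓝 0) (𝓝 t) :=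
    (by fun_prop : Continuous fun s : ℝ => t + s).tendsto' _ _ (add_zero t)
  filter_upwards [ht.eventually (eventually_contMDiffAt hc)] with s hs
  have hs' : ContMDiffAt 𝓘(ℝ, ℝ) 𝓘(ℝ, E) (k : ℕ∞) (fun r => c (t + r)) s :=
    ContMDiffAt.comp s hs (by fun_prop : ContDiffAt ℝ (k : ℕ∞) (fun r : ℝ => t + r) s).contMDiffAt
  rw [reducedCurve_eq_deriv S (hs.mdifferentiableAt hk0),
    reducedCurve_eq_deriv S (hs'.mdifferentiableAt hk0), ← deriv_comp_const_add]

/-- A formal solution started at the unit supplies, smoothly in ζ, a curve whose reduced jet is ζ.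
Hence the quotient map is onto, the default value of `Function.extend` never occurs, and ℓ is a
smooth local expression of `L` evaluated on a smooth function of ζ. -/
theorem contDiff_reducedLagrangian {S : Side} {k : ℕ} (hk : 1 ≤ k) {L : HigherTangent E k G → ℝ}
    (hL : IsSmoothLagrangian L) (hinv : IsInvariantLagrangian S L) :
    ContDiff ℝ ∞ (reducedLagrangian S L) := by
  have hp := unitPoint_mem_target (E := E) (G := G)
  obtain ⟨Q, hQ, hQ0, hQd⟩ := exists_formal_solution (contDiffAt_mcFrame (G := G) S hp) k k
  have hQs : ∀ ζ, ContDiffAt ℝ ∞ (Q ζ) 0 := fun ζ =>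
    ContDiffAt.fun_comp (f := fun s : ℝ => (ζ, s)) (0 : ℝ) (hQ ζ) (by fun_prop)
  have hc : ∀ ζ, ContMDiffAt 𝓘(ℝ, ℝ) 𝓘(ℝ, E) (k : ℕ∞) (fun s => (unitChart E G).symm (Q ζ s)) 0 :=
    fun ζ => contMDiffAt_chart_symm_comp unitChart_mem
      ((hQs ζ).of_le (by exact_mod_cast le_top)) (by rwa [hQ0])
  have hmem : ∀ ζ, ∀ᶠ s in 𝓝 (0 : ℝ), Q ζ s ∈ (unitChart E G).target := fun ζ =>
    (hQs ζ).continuousAt.preimage_mem_nhds ((unitChart E G).open_target.mem_nhds (by rwa [hQ0]))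
  have hξ : ∀ ζ, derivTuple k (reducedCurve E S fun s => (unitChart E G).symm (Q ζ s)) 0 = ζ := by
    intro ζ
    obtain ⟨n, rfl⟩ : ∃ n, k = n + 1 := ⟨k - 1, by omega⟩
    have hle : (n : WithTop ℕ∞) ≤ ∞ := by exact_mod_cast le_top
    have hle' : (n : WithTop ℕ∞) ≤ (n + 1 : ℕ) := by exact_mod_cast Nat.le_succ n
    obtain ⟨-, a2, -, -⟩ := reducedCurve_chart S (hc ζ)
    have e0 : S.translate ((unitChart E G).symm (Q ζ 0))⁻¹ = id := by
      funext x
      rw [hQ0, unitChart_symm_unitPoint, inv_one, S.one_translate, id]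
    simp only [e0, id] at a2
    have e1 : (fun s => unitChart E G ((unitChart E G).symm (Q ζ s))) =ᶠ[𝓝 0] Q ζ := by
      filter_upwards [hmem ζ] with s hs
      exact (unitChart E G).right_inv hs
    have e2 : reducedCurve E S (fun s => (unitChart E G).symm (Q ζ s)) =ᶠ[𝓝 0] fun s =>
        mcForm G S (Q ζ s) (deriv (Q ζ) s) := by
      filter_upwards [a2, e1.eventuallyEq_nhds] with s h1 h2
      rw [h1, h2.deriv_eq, h2.eq_of_nhds]
    have e3 : (fun s => mcForm G S (Q ζ s) (mcFrame G S (Q ζ s) (taylorCurve ζ s))) =ᶠ[𝓝 0]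
        taylorCurve ζ := by
      filter_upwards [hmem ζ] with s hs
      exact congr($(mcForm_comp_mcFrame S hs) _)
    have hF : ContDiffAt ℝ ∞ (fun s => mcFrame G S (Q ζ s) (taylorCurve ζ s)) 0 :=
      (ContDiffAt.fun_comp (g := mcFrame G S) 0 (by
        rw [hQ0]; exact contDiffAt_mcFrame S hp) (hQs ζ)).clm_apply (contDiffAt_taylorCurve ζ 0)
    funext i
    -- The equation holds only to finite order at 0, which is enough: the reduced velocity then has
    -- the same (k-1)-jet as form ∘ frame applied to the polynomial with jet ζ, that is, as the
    -- polynomial itself.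
    have h1 := iteratedDeriv_clm_apply_congr (A := mcForm G S) (t := 0) (m := n)
      (by rw [hQ0]; exact contDiffAt_mcForm S hp)
      ((hQs ζ).of_le hle) ((hQs ζ).of_le hle) ((contDiffAt_deriv (hQs ζ)).of_le hle)
      (hF.of_le hle) (fun _ _ => rfl)
      (fun j hj => by rw [← iteratedDeriv_succ']; exact hQd ζ j (by omega)) i (by omega)
    rw [derivTuple, e2.iteratedDeriv_eq, h1, e3.iteratedDeriv_eq, iteratedDeriv_taylorCurve]
  have key : reducedLagrangian S L = fun ζ =>
      localLagrangian L (unitChart E G) (derivTuple (k + 1) (Q ζ) 0) := by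
    funext ζ
    have h1 := lagrangianAlong_eq_reducedLagrangian hk hinv (hc ζ)
    rw [hξ ζ] at h1
    rw [← h1, lagrangianAlong_eq_localLagrangian L unitChart_mem (hc ζ) (by
      simp only [hQ0]; exact (unitChart E G).map_target hp)]
    congr 1
    refine derivTuple_congr ?_
    filter_upwards [hmem ζ] with s hs
    exact (unitChart E G).right_inv hs
  rw [key]
  refine contDiff_iff_contDiffAt.2 fun ζ => ContDiffAt.fun_comp (g := localLagrangian L (unitChart E G))
    (f := fun ζ => derivTuple (k + 1) (Q ζ) 0) ζ (contDiffAt_localLagrangian hL unitChart_mem ?_) ?_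
  · simpa [derivTuple, hQ0] using hp
  · exact contDiffAt_pi.2 fun i => ContDiffAt.fun_comp (f := fun ζ : Fin k → E => (ζ, (0 : ℝ))) ζ
      (contDiffAt_iteratedDeriv_right (hQ ζ) i) (by fun_prop)

end ReducedLagrangian

/-! ### Compactly supported test curves and passage to the endpoints. -/

section Localization

variable {E : Type*} [NormedAddCommGroup E] [NormedSpace ℝ E]

theorem iteratedDeriv_eq_zero_of_notMem_tsupport {η : ℝ → E} {a b τ : ℝ} (hη : tsupport η ⊆ Ioo a b)
    (hτ : τ ∉ Ioo a b) (j : ℕ) : iteratedDeriv j η τ = 0 := by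
  have h1 : η =ᶠ[𝓝 τ] fun _ => 0 := notMem_tsupport_iff_eventuallyEq.1 fun h => hτ (hη h)
  rw [h1.iteratedDeriv_eq, iteratedDeriv_fun_const_zero]

theorem contMDiffAt_of_smoothNear {F : Type*} [NormedAddCommGroup F] [NormedSpace ℝ F]
    {M : Type*} [TopologicalSpace M] [ChartedSpace E M] {f : F → M} {s : Set F}
    (hf : SmoothNear (E := E) f s) {x : F} (hx : x ∈ s) : ContMDiffAt 𝓘(ℝ, F) 𝓘(ℝ, E) ∞ f x := by
  obtain ⟨U, hU, hsU, h⟩ := hf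
  exact h.contMDiffAt (hU.mem_nhds (hsU hx))

theorem eq_zero_of_continuousAt_of_Ioo {F : Type*} [NormedAddCommGroup F] {f : ℝ → F} {a b t : ℝ}
    (hab : a < b) (ht : t ∈ Icc a b) (hf : ContinuousAt f t)
    (h : ∀ᶠ s in 𝓝 t, s ∈ Ioo a b → f s = 0) : f t = 0 := by
  have hne : (𝓝[Ioo a b] t).NeBot := by
    rwa [← mem_closure_iff_nhdsWithin_neBot, closure_Ioo hab.ne]
  have h1 : Tendsto f (𝓝[Ioo a b] t) (𝓝 (f t)) := hf.tendsto.mono_left nhdsWithin_le_nhds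
  refine tendsto_nhds_unique (h1.congr' ?_) tendsto_const_nhds
  rw [EventuallyEq, eventually_nhdsWithin_iff]
  exact h

end Localization

/-! ### Equivalence of the reduced principle and the Euler–Poincaré equations. -/

section ReducedPrinciple

variable {E : Type*} [NormedAddCommGroup E] [NormedSpace ℝ E] [FiniteDimensional ℝ E]
variable {G : Type*} [TopologicalSpace G] [ChartedSpace E G] [Group G] [LieGroup 𝓘(ℝ, E) ∞ G]

variable (G) in
/-- The left hand side of the Euler-Poincaré equations. -/
def eulerPoincareOperator {k : ℕ} (S : Side) (l : (Fin k → E) → ℝ) (ξ : ℝ → E) (t : ℝ) : E →L[ℝ] ℝ :=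
  deriv (eulerOperator l ξ) t + S.sign • adStar G (ξ t) (eulerOperator l ξ t)

theorem eulerPoincareOperator_apply {k : ℕ} (S : Side) (l : (Fin k → E) → ℝ) (ξ : ℝ → E) (t : ℝ)
    (v : E) : eulerPoincareOperator G S l ξ t v =
      deriv (eulerOperator l ξ) t v + S.sign * eulerOperator l ξ t (bracket G (ξ t) v) := rfl

variable (E G) in
theorem exists_bracket_eq : ∃ A : E →L[ℝ] E →L[ℝ] E, ∀ a b : E, bracket G a b = A a b := by
  have : CompleteSpace E := FiniteDimensional.complete ℝ E
  exact ⟨fderiv ℝ (mcFrame G .left) (unitPoint E G) -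
    (fderiv ℝ (mcFrame G .left) (unitPoint E G)).flip, fun a b => bracket_eq_fderiv_mcFrame a b⟩

theorem contDiffAt_eulerPoincareOperator_apply {k : ℕ} (S : Side) {l : (Fin k → E) → ℝ}
    (hl : ContDiff ℝ ∞ l) {ξ η : ℝ → E} {t : ℝ} (hξ : ContDiffAt ℝ ∞ ξ t) (hη : ContDiffAt ℝ ∞ η t) :
    ContDiffAt ℝ ∞ (fun s => eulerPoincareOperator G S l ξ s (η s)) t := by
  have : CompleteSpace E := FiniteDimensional.complete ℝ E
  have hM := contDiffAt_eulerOperator hξ hl.contDiffAt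
  simp only [eulerPoincareOperator_apply]
  exact ((contDiffAt_deriv hM).clm_apply hη).add
    (contDiffAt_const.mul (hM.clm_apply (contDiffAt_bracket hξ hη)))

/-- The bracket is continuous and bilinear, so its jet along the curves depends only on the jets of
`ξ` and `η`, and `η` may be replaced by 0. -/
theorem iteratedDeriv_bracket_eq_zero {ξ η : ℝ → E} {t : ℝ} {m : ℕ} (hξ : ContDiffAt ℝ ∞ ξ t)
    (hη : ContDiffAt ℝ ∞ η t) (h : ∀ j ≤ m, iteratedDeriv j η t = 0) :
    ∀ j ≤ m, iteratedDeriv j (fun s => bracket G (ξ s) (η s)) t = 0 := by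
  obtain ⟨A, hA⟩ := exists_bracket_eq E G
  have hle : (m : WithTop ℕ∞) ≤ ∞ := by exact_mod_cast le_top
  intro j hj
  have h1 := iteratedDeriv_clm_apply_congr (A := A) (m := m) (v₂ := fun _ => 0) A.contDiff.contDiffAt
    (hξ.of_le hle) (hξ.of_le hle) (hη.of_le hle) contDiffAt_const (fun _ _ => rfl)
    (fun i hi => by rw [h i hi, iteratedDeriv_fun_const_zero]) j hj
  simp only [hA]
  rw [h1]
  simp

/-- The first variation of the reduced action. -/
theorem hasDerivAt_reducedAction (S : Side) {k : ℕ} (hk : 1 ≤ k) {l : (Fin k → E) → ℝ}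
    (hl : ContDiff ℝ ∞ l) {x : ℝ → ℝ → E} {ξ η : ℝ → E} {a b : ℝ} (hab : a ≤ b)
    (hx : ∀ t ∈ Icc a b, ContDiffAt ℝ ∞ (fun p : ℝ × ℝ => x p.1 p.2) (0, t))
    (hξ : ∀ t ∈ Icc a b, ContDiffAt ℝ ∞ ξ t) (hη : ∀ t ∈ Icc a b, ContDiffAt ℝ ∞ η t)
    (hx0 : ∀ t ∈ Ioo a b, x 0 t = ξ t)
    (hxη : ∀ t ∈ Ioo a b,
      deriv (fun ε => x ε t) 0 = deriv η t - S.sign • bracket G (ξ t) (η t))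
    (ha : ∀ j < k, iteratedDeriv j η a = 0) (hb : ∀ j < k, iteratedDeriv j η b = 0) :
    HasDerivAt (fun ε => ∫ t in a..b, l (derivTuple k (x ε) t))
      (-∫ t in a..b, eulerPoincareOperator G S l ξ t (η t)) 0 := by
  have : CompleteSpace E := FiniteDimensional.complete ℝ E
  have hbr : ∀ t ∈ Icc a b, ContDiffAt ℝ ∞ (fun t => bracket G (ξ t) (η t)) t := fun t ht =>
    contDiffAt_bracket (hξ t ht) (hη t ht)
  have hw : ∀ t ∈ Icc a b,
      ContDiffAt ℝ ∞ (fun t => deriv η t - S.sign • bracket G (ξ t) (η t)) t := fun t ht =>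
    (contDiffAt_deriv (hη t ht)).sub ((hbr t ht).const_smul S.sign)
  -- The boundary terms of ℓ involve δξ up to order k - 2, hence `η` up to order k - 1: exactly the
  -- derivatives assumed to vanish.
  have hw0 : ∀ τ ∈ Icc a b, (∀ j < k, iteratedDeriv j η τ = 0) → ∀ i, i + 1 < k →
      iteratedDeriv i (fun t => deriv η t - S.sign • bracket G (ξ t) (η t)) τ = 0 := by
    intro τ hτ h0 i hi
    have hle : (i : WithTop ℕ∞) ≤ ∞ := by exact_mod_cast le_top
    have h1 := iteratedDeriv_sub (n := i) ((contDiffAt_deriv (hη τ hτ)).of_le hle)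
      (((hbr τ hτ).const_smul S.sign).of_le hle)
    have h2 := iteratedDeriv_const_smul ((hbr τ hτ).of_le hle) S.sign
    have h3 := iteratedDeriv_bracket_eq_zero (G := G) (hξ τ hτ) (hη τ hτ) (m := i)
      (fun j hj => h0 j (by omega)) i le_rfl
    refine h1.trans ?_
    rw [← iteratedDeriv_succ', h0 (i + 1) hi, zero_sub, neg_eq_zero]
    refine h2.trans ?_
    rw [h3, smul_zero]
  have key := hasDerivAt_action hab hx hξ hw (fun _ _ => hl.contDiffAt) (fun _ _ => hl.contDiffAt)
    hx0 hxη (hw0 a (left_mem_Icc.2 hab) ha) (hw0 b (right_mem_Icc.2 hab) hb)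
  have hM : ∀ t ∈ Icc a b, ContDiffAt ℝ ∞ (eulerOperator l ξ) t := fun t ht =>
    contDiffAt_eulerOperator (hξ t ht) hl.contDiffAt
  have i1 : IntervalIntegrable (fun t => eulerPoincareOperator G S l ξ t (η t)) volume a b :=
    intervalIntegrable_of_contDiffAt hab fun t ht =>
      contDiffAt_eulerPoincareOperator_apply S hl (hξ t ht) (hη t ht)
  have i2 : IntervalIntegrable (fun t => eulerOperator l ξ t
      (deriv η t - S.sign • bracket G (ξ t) (η t))) volume a b :=
    intervalIntegrable_of_contDiffAt hab fun t ht => (hM t ht).clm_apply (hw t ht)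
  -- The last integration by parts, which removes the derivative from `η`: the two bracket terms
  -- cancel, so the sum is a total derivative whose boundary values vanish.
  have hd : ∀ t ∈ uIcc a b, HasDerivAt (fun t => eulerOperator l ξ t (η t))
      (eulerPoincareOperator G S l ξ t (η t) +
        eulerOperator l ξ t (deriv η t - S.sign • bracket G (ξ t) (η t))) t := by
    intro t ht
    rw [uIcc_of_le hab] at ht
    have h1 := ((hM t ht).differentiableAt (by simp)).hasDerivAt.clm_apply
      ((hη t ht).differentiableAt (by simp)).hasDerivAt
    have e : eulerPoincareOperator G S l ξ t (η t) +
        eulerOperator l ξ t (deriv η t - S.sign • bracket G (ξ t) (η t)) =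
        deriv (eulerOperator l ξ) t (η t) + eulerOperator l ξ t (deriv η t) := by
      rw [eulerPoincareOperator_apply, map_sub, map_smul, smul_eq_mul]
      ring
    rw [e]
    exact h1
  have h2 := intervalIntegral.integral_eq_sub_of_hasDerivAt hd (i1.add i2)
  have ha0 : η a = 0 := by simpa using ha 0 hk
  have hb0 : η b = 0 := by simpa using hb 0 hk
  rw [intervalIntegral.integral_add i1 i2, ha0, hb0, map_zero, map_zero, sub_zero] at h2
  rwa [eq_neg_of_add_eq_zero_right h2] at key

theorem eulerPoincare_of_Ioo (S : Side) {k : ℕ} {l : (Fin k → E) → ℝ} (hl : ContDiff ℝ ∞ l)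
    {ξ : ℝ → E} {t₀ t₁ : ℝ} (ht : t₀ < t₁) (hξ : ∀ t ∈ Icc t₀ t₁, ContDiffAt ℝ ∞ ξ t)
    (h : ∀ t ∈ Ioo t₀ t₁, ∀ v, eulerPoincareOperator G S l ξ t v = 0) :
    EulerPoincare G S l ξ t₀ t₁ := by
  intro t hts
  refine ContinuousLinearMap.ext fun v => ?_
  exact eq_zero_of_continuousAt_of_Ioo (f := fun s => eulerPoincareOperator G S l ξ s v) ht hts
    (contDiffAt_eulerPoincareOperator_apply S hl (hξ t hts) contDiffAt_const).continuousAt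
    (Eventually.of_forall fun s hs => h s hs v)

theorem eulerPoincareOperator_eq_zero_of_integral (S : Side) {k : ℕ} {l : (Fin k → E) → ℝ}
    (hl : ContDiff ℝ ∞ l) {ξ : ℝ → E} {a b : ℝ} (hab : a ≤ b)
    (hξ : ∀ t ∈ Icc a b, ContDiffAt ℝ ∞ ξ t)
    (h : ∀ η : ℝ → E, ContDiff ℝ ∞ η → tsupport η ⊆ Ioo a b →
      ∫ t in a..b, eulerPoincareOperator G S l ξ t (η t) = 0) :
    ∀ t ∈ Ioo a b, ∀ v, eulerPoincareOperator G S l ξ t v = 0 :=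
  eq_zero_of_integral_apply_eq_zero (μ := fun t v => eulerPoincareOperator G S l ξ t v) hab
    (fun _ t hts => (contDiffAt_eulerPoincareOperator_apply S hl (hξ t (Ioo_subset_Icc_self hts))
      contDiffAt_const).continuousAt.continuousWithinAt)
    (fun t c v => by rw [map_smul, smul_eq_mul]) h

/-- The reduced principle is equivalent to the Euler-Poincaré equations. -/
theorem reducedPrinciple_iff_eulerPoincare (S : Side) {k : ℕ} (hk : 1 ≤ k) {l : (Fin k → E) → ℝ}
    (hl : ContDiff ℝ ∞ l) {ξ : ℝ → E} {t₀ t₁ : ℝ} (ht : t₀ < t₁)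
    (hξ : SmoothNear (E := E) ξ (Icc t₀ t₁)) :
    ReducedPrinciple G S l ξ t₀ t₁ ↔ EulerPoincare G S l ξ t₀ t₁ := by
  have : CompleteSpace E := FiniteDimensional.complete ℝ E
  have hξ' : ∀ t ∈ Icc t₀ t₁, ContDiffAt ℝ ∞ ξ t := fun t hts =>
    (contMDiffAt_of_smoothNear hξ hts).contDiffAt
  constructor
  · intro h
    refine eulerPoincare_of_Ioo S hl ht hξ' ?_
    refine eulerPoincareOperator_eq_zero_of_integral S hl ht.le hξ' fun η hη hsupp => ?_
    have h0 := fun j => iteratedDeriv_eq_zero_of_notMem_tsupport hsupp (τ := t₀) (by simp) j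
    have h1 := fun j => iteratedDeriv_eq_zero_of_notMem_tsupport hsupp (τ := t₁) (by simp) j
    obtain ⟨U, hU, hIU, hξU⟩ := hξ
    -- The variation affine in ε with the prescribed δξ; condition (iv) does not ask that it come
    -- from curves in the group.
    have hΞ : ∀ p : ℝ × ℝ, p.2 ∈ U → ContDiffAt ℝ ∞ (fun p : ℝ × ℝ =>
        ξ p.2 + p.1 • (deriv η p.2 - S.sign • bracket G (ξ p.2) (η p.2))) p := by
      intro p hp
      have c1 : ContDiffAt ℝ ∞ (fun p : ℝ × ℝ => ξ p.2) p :=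
        ContDiffAt.fun_comp p (hξU.contMDiffAt (hU.mem_nhds hp)).contDiffAt contDiffAt_snd
      have c2 : ContDiffAt ℝ ∞ (fun p : ℝ × ℝ => η p.2) p :=
        ContDiffAt.fun_comp p hη.contDiffAt contDiffAt_snd
      have c3 : ContDiffAt ℝ ∞ (fun p : ℝ × ℝ => deriv η p.2) p :=
        ContDiffAt.fun_comp p (contDiffAt_deriv hη.contDiffAt) contDiffAt_snd
      exact c1.add (contDiffAt_fst.smul (c3.sub ((contDiffAt_bracket c1 c2).const_smul S.sign)))
    have hder : ∀ t, deriv (fun ε : ℝ =>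
        ξ t + ε • (deriv η t - S.sign • bracket G (ξ t) (η t))) 0 =
          deriv η t - S.sign • bracket G (ξ t) (η t) := by
      intro t
      have h2 := ((hasDerivAt_id (0 : ℝ)).smul_const
        (deriv η t - S.sign • bracket G (ξ t) (η t))).const_add (ξ t)
      rw [one_smul] at h2
      exact h2.deriv
    have key := h η ⟨univ, isOpen_univ, subset_univ _, hη.contMDiff.contMDiffOn⟩
      (fun j _ => ⟨h0 j, h1 j⟩)
      (fun ε t => ξ t + ε • (deriv η t - S.sign • bracket G (ξ t) (η t)))
      ⟨⟨univ ×ˢ U, isOpen_univ.prod hU, prod_mono (subset_univ _) hIU, fun p hp =>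
        (hΞ p hp.2).contMDiffAt.contMDiffWithinAt⟩, fun t _ => by simp⟩ (fun t _ => hder t)
    have key' := hasDerivAt_reducedAction (G := G) S hk hl ht.le
      (x := fun ε t => ξ t + ε • (deriv η t - S.sign • bracket G (ξ t) (η t)))
      (fun t hts => hΞ (0, t) (hIU hts)) hξ' (fun t _ => hη.contDiffAt) (fun t _ => by simp)
      (fun t _ => hder t) (fun j _ => h0 j) (fun j _ => h1 j)
    exact neg_eq_zero.1 (key'.unique key)
  · intro h η hη hη0 Ξ hΞ hδ
    have key := hasDerivAt_reducedAction (G := G) S hk hl ht.le (x := Ξ)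
      (fun t hts => (contMDiffAt_of_smoothNear hΞ.1 (x := (0, t)) ⟨rfl, hts⟩).contDiffAt) hξ'
      (fun t hts => (contMDiffAt_of_smoothNear hη hts).contDiffAt)
      (fun t hts => hΞ.2 t (Ioo_subset_Icc_self hts)) (fun t hts => hδ t (Ioo_subset_Icc_self hts))
      (fun j hj => (hη0 j hj).1) (fun j hj => (hη0 j hj).2)
    have h0 : ∫ t in t₀..t₁, eulerPoincareOperator G S l ξ t (η t) = 0 := by
      rw [intervalIntegral_congr_Ioo (g := fun _ => 0) ht.le fun t hts => ?_]
      · simp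
      · exact congr($(h t (Ioo_subset_Icc_self hts)) (η t))
    rwa [h0, neg_zero] at key

end ReducedPrinciple

/-! ### Hamilton's principle and the Euler–Lagrange equations. -/

section Hamilton

variable {E : Type*} [NormedAddCommGroup E] [NormedSpace ℝ E]

section Manifold

variable {M : Type*} [TopologicalSpace M] [ChartedSpace E M]

/-- Compactness makes the range of ε uniform in `t`; for such ε the default value 0 of
`lagrangianAlong` plays no role. -/
theorem eventually_forall_contMDiffAt [IsManifold 𝓘(ℝ, E) ∞ M] {γ : ℝ → ℝ → M} {a b : ℝ}
    (hγ : ∀ t ∈ Icc a b, ContMDiffAt 𝓘(ℝ, ℝ × ℝ) 𝓘(ℝ, E) ∞ (fun p : ℝ × ℝ => γ p.1 p.2) (0, t))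
    (m : ℕ) : ∀ᶠ ε in 𝓝 (0 : ℝ), ∀ t ∈ Icc a b, ContMDiffAt 𝓘(ℝ, ℝ) 𝓘(ℝ, E) (m : ℕ∞) (γ ε) t := by
  refine isCompact_Icc.eventually_forall_of_forall_eventually fun t ht => ?_
  filter_upwards [eventually_contMDiffAt (m := m) ((hγ t ht).of_le (by exact_mod_cast le_top))]
    with p hp
  exact ContMDiffAt.comp_of_eq (f := fun s : ℝ => (p.1, s)) (x := p.2) hp
    (by fun_prop : ContDiffAt ℝ (m : ℕ∞) (fun s : ℝ => (p.1, s)) p.2).contMDiffAt rfl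

/-- The first variation of the action, in a chart containing the curve. -/
theorem hasDerivAt_action_chart [IsManifold 𝓘(ℝ, E) ∞ M] {k : ℕ} {L : HigherTangent E k M → ℝ}
    (hL : IsSmoothLagrangian L) {e : OpenPartialHomeomorph M E} (he : e ∈ smoothCharts E M)
    {γ : ℝ → ℝ → M} {g : ℝ → M} {a b : ℝ} (hab : a ≤ b)
    (hγ : ∀ t ∈ Icc a b, ContMDiffAt 𝓘(ℝ, ℝ × ℝ) 𝓘(ℝ, E) ∞ (fun p : ℝ × ℝ => γ p.1 p.2) (0, t))
    (hg : ∀ t ∈ Icc a b, ContMDiffAt 𝓘(ℝ, ℝ) 𝓘(ℝ, E) ∞ g t)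
    (hγg : ∀ t ∈ Icc a b, γ 0 t = g t) (hs : ∀ t ∈ Icc a b, g t ∈ e.source)
    (ha : ∀ j < k, iteratedDeriv j (fun t => deriv (fun ε => e (γ ε t)) 0) a = 0)
    (hb : ∀ j < k, iteratedDeriv j (fun t => deriv (fun ε => e (γ ε t)) 0) b = 0) :
    HasDerivAt (fun ε => ∫ t in a..b, lagrangianAlong L (γ ε) t)
      (∫ t in a..b, eulerOperator (localLagrangian L e) (fun s => e (g s)) t
        (deriv (fun ε => e (γ ε t)) 0)) 0 := by
  have hx : ∀ t ∈ Icc a b, ContDiffAt ℝ ∞ (fun p : ℝ × ℝ => e (γ p.1 p.2)) (0, t) := fun t ht =>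
    contDiffAt_chart_comp (n := ⊤) he (hγ t ht) (by simp only [hγg t ht]; exact hs t ht)
  have hw : ∀ t ∈ Icc a b, ContDiffAt ℝ ∞ (fun t => deriv (fun ε => e (γ ε t)) 0) t := fun t ht =>
    ContDiffAt.fun_comp (f := fun s : ℝ => ((0 : ℝ), s)) t (contDiffAt_deriv_left (hx t ht))
      (by fun_prop)
  have key := hasDerivAt_action (n := k + 1) (f := localLagrangian L e) (x := fun ε t => e (γ ε t))
    (ξ := fun t => e (g t)) (w := fun t => deriv (fun ε => e (γ ε t)) 0) hab hx
    (fun t ht => contDiffAt_chart_comp (n := ⊤) he (hg t ht) (hs t ht)) hw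
    (fun t ht => contDiffAt_localLagrangian hL he (by
      simpa [derivTuple, hγg t ht] using e.map_source (hs t ht)))
    (fun t ht => contDiffAt_localLagrangian hL he (by
      simpa [derivTuple] using e.map_source (hs t ht)))
    (fun t ht => by rw [hγg t (Ioo_subset_Icc_self ht)]) (fun t _ => rfl)
    (fun i hi => ha i (by omega)) (fun i hi => hb i (by omega))
  refine key.congr_of_eventuallyEq ?_
  have hev : ∀ᶠ ε in 𝓝 (0 : ℝ), ∀ t ∈ Icc a b, γ ε t ∈ e.source := by
    refine isCompact_Icc.eventually_forall_of_forall_eventually fun t ht => ?_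
    exact (hγ t ht).continuousAt.preimage_mem_nhds (e.open_source.mem_nhds (by
      simp only [hγg t ht]; exact hs t ht))
  filter_upwards [hev, eventually_forall_contMDiffAt hγ k] with ε h1 h2
  refine intervalIntegral.integral_congr fun t ht => ?_
  rw [uIcc_of_le hab] at ht
  exact lagrangianAlong_eq_localLagrangian L he (h2 t ht) (h1 t ht)

end Manifold

variable {G : Type*} [TopologicalSpace G] [ChartedSpace E G] [Group G]

theorem reducedCurve_congr (S : Side) {c₁ c₂ : ℝ → G} {t : ℝ} (h : c₁ =ᶠ[𝓝 t] c₂) :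
    reducedCurve E S c₁ t = reducedCurve E S c₂ t := by
  unfold reducedCurve
  rw [h.mfderiv_eq, h.eq_of_nhds]

/-- The variation of `g` with prescribed reduced variation `η`. -/
def groupVariation (S : Side) (g : ℝ → G) (η : ℝ → E) (ε t : ℝ) : G :=
  S.translate (g t) ((unitChart E G).symm (unitPoint E G + ε • η t))

theorem groupVariation_of_eq_zero (S : Side) (g : ℝ → G) {η : ℝ → E} {t : ℝ} (h : η t = 0) (ε : ℝ) :
    groupVariation S g η ε t = g t := by
  rw [groupVariation, h, smul_zero, add_zero, unitChart_symm_unitPoint, S.translate_one]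

theorem groupVariation_zero (S : Side) (g : ℝ → G) (η : ℝ → E) (t : ℝ) :
    groupVariation S g η 0 t = g t := by
  rw [groupVariation, zero_smul, add_zero, unitChart_symm_unitPoint, S.translate_one]

variable [LieGroup 𝓘(ℝ, E) ∞ G]

theorem reducedCurve_const (S : Side) (c : G) (t : ℝ) : reducedCurve E S (fun _ => c) t = 0 := by
  rw [reducedCurve_eq_deriv S mdifferentiableAt_const]
  simp

theorem contDiffAt_reducedCurve_of_contMDiffAt (S : Side) {g : ℝ → G} {t : ℝ}
    (hg : ContMDiffAt 𝓘(ℝ, ℝ) 𝓘(ℝ, E) ∞ g t) : ContDiffAt ℝ ∞ (reducedCurve E S g) t := by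
  have h1 : ContMDiffAt 𝓘(ℝ, ℝ × ℝ) 𝓘(ℝ, E) ∞ (fun p : ℝ × ℝ => g p.2) (0, t) :=
    ContMDiffAt.comp (f := fun p : ℝ × ℝ => p.2) (0, t) hg contDiffAt_snd.contMDiffAt
  exact ContDiffAt.fun_comp (f := fun s : ℝ => ((0 : ℝ), s)) t
    (contDiffAt_reducedCurve S (γ := fun _ => g) h1) (by fun_prop)

theorem smoothNear_reducedCurve (S : Side) {g : ℝ → G} {s : Set ℝ}
    (hg : SmoothNear (E := E) g s) : SmoothNear (E := E) (reducedCurve E S g) s := by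
  obtain ⟨U, hU, hsU, h⟩ := hg
  exact ⟨U, hU, hsU, fun t ht => (contDiffAt_reducedCurve_of_contMDiffAt S
    (h.contMDiffAt (hU.mem_nhds ht))).contMDiffAt.contMDiffWithinAt⟩

theorem contDiffAt_reducedVariation (S : Side) {γ : ℝ → ℝ → G} {t : ℝ}
    (hγ : ContMDiffAt 𝓘(ℝ, ℝ × ℝ) 𝓘(ℝ, E) ∞ (fun p : ℝ × ℝ => γ p.1 p.2) (0, t)) :
    ContDiffAt ℝ ∞ (fun s => reducedCurve E S (fun ε => γ ε s) 0) t :=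
  ContDiffAt.fun_comp (f := fun s : ℝ => ((0 : ℝ), s)) t (contDiffAt_reducedCurve_left S hγ)
    (by fun_prop)

/-- The first variation of the action of an invariant Lagrangian. -/
theorem hasDerivAt_invariantAction [FiniteDimensional ℝ E] {S : Side} {k : ℕ} (hk : 1 ≤ k)
    {L : HigherTangent E k G → ℝ} (hL : IsSmoothLagrangian L) (hinv : IsInvariantLagrangian S L)
    {γ : ℝ → ℝ → G} {g : ℝ → G} {a b : ℝ} (hab : a ≤ b)
    (hγ : ∀ t ∈ Icc a b, ContMDiffAt 𝓘(ℝ, ℝ × ℝ) 𝓘(ℝ, E) ∞ (fun p : ℝ × ℝ => γ p.1 p.2) (0, t))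
    (hg : ∀ t ∈ Icc a b, ContMDiffAt 𝓘(ℝ, ℝ) 𝓘(ℝ, E) ∞ g t)
    (hγg : ∀ t ∈ Icc a b, γ 0 t = g t)
    (ha : ∀ j < k, iteratedDeriv j (fun t => reducedCurve E S (fun ε => γ ε t) 0) a = 0)
    (hb : ∀ j < k, iteratedDeriv j (fun t => reducedCurve E S (fun ε => γ ε t) 0) b = 0) :
    HasDerivAt (fun ε => ∫ t in a..b, lagrangianAlong L (γ ε) t)
      (-∫ t in a..b, eulerPoincareOperator G S (reducedLagrangian S L) (reducedCurve E S g) t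
        (reducedCurve E S (fun ε => γ ε t) 0)) 0 := by
  have : CompleteSpace E := FiniteDimensional.complete ℝ E
  -- The reduced curve involves a derivative, so equality of `γ 0` and `g` on the closed interval
  -- transfers only to interior times.
  have h0 : ∀ t ∈ Ioo a b, reducedCurve E S (γ 0) t = reducedCurve E S g t := fun t ht =>
    reducedCurve_congr S (by
      filter_upwards [isOpen_Ioo.mem_nhds ht] with s hs using hγg s (Ioo_subset_Icc_self hs))
  have key := hasDerivAt_reducedAction (G := G) S hk (contDiff_reducedLagrangian hk hL hinv) hab
    (x := fun ε => reducedCurve E S (γ ε)) (ξ := reducedCurve E S g)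
    (η := fun t => reducedCurve E S (fun ε => γ ε t) 0)
    (fun t ht => contDiffAt_reducedCurve S (hγ t ht))
    (fun t ht => contDiffAt_reducedCurve_of_contMDiffAt S (hg t ht))
    (fun t ht => contDiffAt_reducedVariation S (hγ t ht)) h0
    (fun t ht => by
      rw [← h0 t ht]
      exact deriv_reducedCurve S (hγ t (Ioo_subset_Icc_self ht))) ha hb
  refine key.congr_of_eventuallyEq ?_
  filter_upwards [eventually_forall_contMDiffAt hγ k] with ε hε
  refine intervalIntegral.integral_congr fun t ht => ?_
  rw [uIcc_of_le hab] at ht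
  exact lagrangianAlong_eq_reducedLagrangian hk hinv (hε t ht)

/-- Near `τ` the reduced variation is T(t) δq(t), with δq the variation in a chart and T(t) a linear
map depending smoothly on t. So vanishing of the jet of δq passes to the reduced variation. -/
theorem iteratedDeriv_reducedVariation_eq_zero (S : Side) {k : ℕ} {γ : ℝ → ℝ → G} {τ : ℝ}
    (hγ : ContMDiffAt 𝓘(ℝ, ℝ × ℝ) 𝓘(ℝ, E) ∞ (fun p : ℝ × ℝ => γ p.1 p.2) (0, τ))
    (h : VariationVanishesAt E k γ τ) :
    ∀ j < k, iteratedDeriv j (fun t => reducedCurve E S (fun ε => γ ε t) 0) τ = 0 := by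
  set e := chartAt E (γ 0 τ) with he'
  have he : e ∈ smoothCharts E G := chartAt_mem_smoothCharts _
  have hτ : γ 0 τ ∈ e.source := mem_chart_source E _
  have hq : ContDiffAt ℝ ∞ (fun p : ℝ × ℝ => e (γ p.1 p.2)) (0, τ) :=
    contDiffAt_chart_comp (n := ⊤) he hγ hτ
  have hslice : ContDiffAt ℝ ∞ (fun s : ℝ => ((0 : ℝ), s)) τ := by fun_prop
  have hw : ContDiffAt ℝ ∞ (fun t => deriv (fun ε => e (γ ε t)) 0) τ :=
    ContDiffAt.fun_comp (f := fun s : ℝ => ((0 : ℝ), s)) τ (contDiffAt_deriv_left hq) hslice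
  have hγ0 : ContMDiffAt 𝓘(ℝ, ℝ) 𝓘(ℝ, E) ∞ (γ 0) τ :=
    ContMDiffAt.comp (f := fun s : ℝ => ((0 : ℝ), s)) τ hγ hslice.contMDiffAt
  let f : ℝ → E → E := fun t y => unitChart E G (S.translate (γ 0 t)⁻¹ (e.symm y))
  have hf : ContDiffAt ℝ ∞ (Function.uncurry f) (τ, e (γ 0 τ)) := by
    refine contDiffAt_chart_comp (n := ⊤) unitChart_mem (contMDiffAt_translate_inv S
      (ContMDiffAt.comp (f := fun p : ℝ × E => p.1) (τ, e (γ 0 τ)) hγ0 contDiffAt_fst.contMDiffAt)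
      (contMDiffAt_chart_symm_comp he contDiffAt_snd (e.map_source hτ))) ?_
    simp only
    rw [e.left_inv hτ, S.translate_inv_self]
    exact one_mem_unitChart_source
  have hq0 : ContDiffAt ℝ ∞ (fun t => e (γ 0 t)) τ :=
    ContDiffAt.fun_comp (f := fun s : ℝ => ((0 : ℝ), s)) τ hq hslice
  have hT : ContDiffAt ℝ ∞ (fun t => fderiv ℝ (f t) (e (γ 0 t))) τ :=
    ContDiffAt.fderiv (f := f) (g := fun t => e (γ 0 t)) hf hq0 le_rfl
  have hY : (fun t => reducedCurve E S (fun ε => γ ε t) 0) =ᶠ[𝓝 τ] fun t =>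
      fderiv ℝ (f t) (e (γ 0 t)) (deriv (fun ε => e (γ ε t)) 0) := by
    have c1 : Tendsto (fun s : ℝ => ((0 : ℝ), s)) (𝓝 τ) (𝓝 (0, τ)) := hslice.continuousAt
    have c2 : Tendsto (fun s : ℝ => (s, e (γ 0 s))) (𝓝 τ) (𝓝 (τ, e (γ 0 τ))) :=
      (continuousAt_id.prodMk hq0.continuousAt)
    have hsrc : ∀ᶠ p : ℝ × ℝ in 𝓝 (0, τ), γ p.1 p.2 ∈ e.source :=
      hγ.continuousAt.preimage_mem_nhds (e.open_source.mem_nhds hτ)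
    filter_upwards [c1.eventually (eventually_contMDiffAt (m := 1)
      (hγ.of_le (by exact_mod_cast le_top))), c1.eventually (eventually_contDiffAt hq 1),
      c2.eventually (eventually_contDiffAt hf 1), c1.eventually hsrc.eventually_nhds]
      with t h1 h2 h3 h4
    have hεt : ContDiffAt ℝ 1 (fun ε : ℝ => (ε, t)) 0 := by fun_prop
    have m1 : MDifferentiableAt 𝓘(ℝ, ℝ) 𝓘(ℝ, E) (fun ε => γ ε t) 0 :=
      MDifferentiableAt.comp (f := fun ε : ℝ => (ε, t)) 0
        (h1.mdifferentiableAt (by simp)) (hεt.contMDiffAt.mdifferentiableAt (by simp))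
    have m2 : HasDerivAt (fun ε => e (γ ε t)) (deriv (fun ε => e (γ ε t)) 0) 0 :=
      (hasDerivAt_comp_mk_left (h2.differentiableAt (by simp))).differentiableAt.hasDerivAt
    have m3 : DifferentiableAt ℝ (f t) (e (γ 0 t)) :=
      DifferentiableAt.comp (g := Function.uncurry f) (f := fun y : E => (t, y)) _
        (h3.differentiableAt (by simp)) (by fun_prop)
    rw [reducedCurve_eq_deriv S m1, ← (m3.hasFDerivAt.comp_hasDerivAt (0 : ℝ) m2).deriv]
    refine Filter.EventuallyEq.deriv_eq ?_
    have c3 : Tendsto (fun ε : ℝ => (ε, t)) (𝓝 0) (𝓝 (0, t)) := hεt.continuousAt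
    filter_upwards [c3.eventually h4] with ε hε
    simp only [f, Function.comp_apply]
    rw [e.left_inv hε]
  intro j hj
  have hle : (j : WithTop ℕ∞) ≤ ∞ := by exact_mod_cast le_top
  -- Taking the identity for `A` makes this a product rule for a moving linear map applied to a
  -- curve.
  have key := iteratedDeriv_clm_apply_congr (A := fun T : E →L[ℝ] E => T)
    (u₁ := fun t => fderiv ℝ (f t) (e (γ 0 t))) (v₁ := fun t => deriv (fun ε => e (γ ε t)) 0)
    (v₂ := fun _ => 0) contDiffAt_id (hT.of_le hle) (hT.of_le hle) (hw.of_le hle) contDiffAt_const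
    (fun _ _ => rfl) (fun i hi => by
      rw [h e he hτ i (by omega), iteratedDeriv_fun_const_zero]) j le_rfl
  rw [hY.iteratedDeriv_eq, key]
  simp

theorem contMDiffAt_groupVariation (S : Side) {g : ℝ → G} {η : ℝ → E} (hη : ContDiff ℝ ∞ η)
    {p : ℝ × ℝ} (hg : ContMDiffAt 𝓘(ℝ, ℝ) 𝓘(ℝ, E) ∞ g p.2)
    (hp : unitPoint E G + p.1 • η p.2 ∈ (unitChart E G).target) :
    ContMDiffAt 𝓘(ℝ, ℝ × ℝ) 𝓘(ℝ, E) ∞ (fun p : ℝ × ℝ => groupVariation S g η p.1 p.2) p := by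
  refine contMDiffAt_translate (n := ⊤) S
    (ContMDiffAt.comp (f := fun p : ℝ × ℝ => p.2) p hg contDiffAt_snd.contMDiffAt)
    (contMDiffAt_chart_symm_comp (n := ⊤) unitChart_mem ?_ hp)
  exact contDiffAt_const.add (contDiffAt_fst.smul
    (ContDiffAt.fun_comp p hη.contDiffAt contDiffAt_snd))

/-- Translating back by g(t) leaves a straight line through the unit in the chart, with velocity
η(t). Hence any smooth `η` is realized as a reduced variation. -/
theorem reducedCurve_groupVariation (S : Side) (g : ℝ → G) (η : ℝ → E) (t : ℝ) :
    reducedCurve E S (fun ε => groupVariation S g η ε t) 0 = η t := by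
  have hu : ContDiffAt ℝ (1 : ℕ∞) (fun ε : ℝ => unitPoint E G + ε • η t) 0 := by fun_prop
  have h0 : unitPoint E G + (0 : ℝ) • η t ∈ (unitChart E G).target := by
    rw [zero_smul, add_zero]
    exact unitPoint_mem_target
  have h1 : ContMDiffAt 𝓘(ℝ, ℝ) 𝓘(ℝ, E) (1 : ℕ∞) (fun ε => groupVariation S g η ε t) 0 :=
    contMDiffAt_translate S contMDiffAt_const (contMDiffAt_chart_symm_comp unitChart_mem hu h0)
  rw [reducedCurve_eq_deriv S (h1.mdifferentiableAt (by simp))]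
  have h2 : HasDerivAt (fun ε : ℝ => unitPoint E G + ε • η t) (η t) 0 := by
    simpa using ((hasDerivAt_id (0 : ℝ)).smul_const (η t)).const_add (unitPoint E G)
  rw [← h2.deriv]
  simp only [h2.deriv]
  refine (h2.congr_of_eventuallyEq ?_).deriv
  filter_upwards [hu.continuousAt.preimage_mem_nhds ((unitChart E G).open_target.mem_nhds h0)]
    with ε hε
  rw [groupVariation_zero, groupVariation, S.translate_inv_translate, (unitChart E G).right_inv hε]

theorem integral_apply_eq_zero {F : ℝ → E →L[ℝ] ℝ} {v : ℝ → E} {a b : ℝ} (hab : a ≤ b)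
    (h : ∀ t ∈ Ioo a b, F t = 0) : ∫ t in a..b, F t (v t) = 0 := by
  rw [intervalIntegral_congr_Ioo (g := fun _ => 0) hab fun t ht => by rw [h t ht]; rfl]
  simp

variable [FiniteDimensional ℝ E]

/-- Hamilton's principle is equivalent to the Euler-Poincaré equations. -/
theorem hamiltonPrinciple_iff_eulerPoincare {S : Side} {k : ℕ} (hk : 1 ≤ k)
    {L : HigherTangent E k G → ℝ} (hL : IsSmoothLagrangian L) (hinv : IsInvariantLagrangian S L)
    {g : ℝ → G} {t₀ t₁ : ℝ} (ht : t₀ < t₁) (hg : SmoothNear (E := E) g (Icc t₀ t₁)) :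
    HamiltonPrinciple L g t₀ t₁ ↔
      EulerPoincare G S (reducedLagrangian S L) (reducedCurve E S g) t₀ t₁ := by
  have hg' : ∀ t ∈ Icc t₀ t₁, ContMDiffAt 𝓘(ℝ, ℝ) 𝓘(ℝ, E) ∞ g t := fun t hts =>
    contMDiffAt_of_smoothNear hg hts
  have hξ : ∀ t ∈ Icc t₀ t₁, ContDiffAt ℝ ∞ (reducedCurve E S g) t := fun t hts =>
    contDiffAt_reducedCurve_of_contMDiffAt S (hg' t hts)
  have hl := contDiff_reducedLagrangian hk hL hinv
  constructor
  · intro h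
    refine eulerPoincare_of_Ioo S hl ht hξ ?_
    refine eulerPoincareOperator_eq_zero_of_integral S hl ht.le hξ fun η hη hsupp => ?_
    -- Outside the support of `η` the variation does not depend on ε, so its jets vanish there in
    -- every chart.
    have hvan : ∀ τ, τ ∉ Ioo t₀ t₁ → VariationVanishesAt E k (groupVariation S g η) τ := by
      intro τ hτ e _ _ j _
      have h1 : η =ᶠ[𝓝 τ] fun _ => 0 := notMem_tsupport_iff_eventuallyEq.1 fun h => hτ (hsupp h)
      have h2 : (fun t => deriv (fun ε => e (groupVariation S g η ε t)) 0) =ᶠ[𝓝 τ] fun _ => 0 := by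
        filter_upwards [h1] with t ht
        simp only [groupVariation_of_eq_zero S g ht, deriv_const]
      rw [h2.iteratedDeriv_eq, iteratedDeriv_fun_const_zero]
    obtain ⟨U, hU, hIU, hgU⟩ := hg
    have hc : Continuous fun p : ℝ × ℝ => unitPoint E G + p.1 • η p.2 := by
      have := hη.continuous
      fun_prop
    have hsm : SmoothNear (E := E) (fun p : ℝ × ℝ => groupVariation S g η p.1 p.2)
        ({0} ×ˢ Icc t₀ t₁) := by
      refine ⟨(univ ×ˢ U) ∩ (fun p : ℝ × ℝ => unitPoint E G + p.1 • η p.2) ⁻¹'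
        (unitChart E G).target, (isOpen_univ.prod hU).inter ((unitChart E G).open_target.preimage hc),
        ?_, fun p hp => (contMDiffAt_groupVariation S hη (hgU.contMDiffAt (hU.mem_nhds hp.1.2))
          hp.2).contMDiffWithinAt⟩
      rintro ⟨ε, t⟩ ⟨hε, hts⟩
      obtain rfl : ε = 0 := hε
      refine ⟨⟨mem_univ _, hIU hts⟩, ?_⟩
      simpa using unitPoint_mem_target (E := E) (G := G)
    have key := h (groupVariation S g η) ⟨hsm, fun t _ => groupVariation_zero S g η t⟩
      (hvan t₀ (by simp)) (hvan t₁ (by simp))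
    have key' := hasDerivAt_invariantAction hk hL hinv ht.le (γ := groupVariation S g η) (g := g)
      (fun t hts => contMDiffAt_of_smoothNear hsm (x := (0, t)) ⟨rfl, hts⟩) hg'
      (fun t _ => groupVariation_zero S g η t)
      (fun j _ => by
        simp only [reducedCurve_groupVariation]
        exact iteratedDeriv_eq_zero_of_notMem_tsupport hsupp (by simp) j)
      (fun j _ => by
        simp only [reducedCurve_groupVariation]
        exact iteratedDeriv_eq_zero_of_notMem_tsupport hsupp (by simp) j)
    simp only [reducedCurve_groupVariation] at key'
    exact neg_eq_zero.1 (key'.unique key)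
  · intro h γ hγ h0 h1
    have hγ' : ∀ t ∈ Icc t₀ t₁,
        ContMDiffAt 𝓘(ℝ, ℝ × ℝ) 𝓘(ℝ, E) ∞ (fun p : ℝ × ℝ => γ p.1 p.2) (0, t) := fun t hts =>
      contMDiffAt_of_smoothNear hγ.1 (x := (0, t)) ⟨rfl, hts⟩
    have key := hasDerivAt_invariantAction hk hL hinv ht.le hγ' hg' hγ.2
      (iteratedDeriv_reducedVariation_eq_zero S (hγ' t₀ (left_mem_Icc.2 ht.le)) h0)
      (iteratedDeriv_reducedVariation_eq_zero S (hγ' t₁ (right_mem_Icc.2 ht.le)) h1)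
    rwa [integral_apply_eq_zero ht.le (F := eulerPoincareOperator G S (reducedLagrangian S L)
      (reducedCurve E S g)) fun t hts => h t (Ioo_subset_Icc_self hts), neg_zero] at key

theorem exists_Icc_subset_of_mem_nhds {U : Set ℝ} {t : ℝ} (hU : U ∈ 𝓝 t) :
    ∃ a b : ℝ, t ∈ Ioo a b ∧ Icc a b ⊆ U := by
  obtain ⟨δ, hδ, h⟩ := Metric.nhds_basis_closedBall.mem_iff.1 hU
  rw [Real.closedBall_eq_Icc] at h
  exact ⟨t - δ, t + δ, ⟨by linarith, by linarith⟩, h⟩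

/-- The Euler-Lagrange equations are equivalent to the Euler-Poincaré equations. -/
theorem eulerLagrange_iff_eulerPoincare {S : Side} {k : ℕ} (hk : 1 ≤ k)
    {L : HigherTangent E k G → ℝ} (hL : IsSmoothLagrangian L) (hinv : IsInvariantLagrangian S L)
    {g : ℝ → G} {t₀ t₁ : ℝ} (ht : t₀ < t₁) (hg : SmoothNear (E := E) g (Icc t₀ t₁)) :
    EulerLagrange L g t₀ t₁ ↔
      EulerPoincare G S (reducedLagrangian S L) (reducedCurve E S g) t₀ t₁ := by
  have hg' : ∀ t ∈ Icc t₀ t₁, ContMDiffAt 𝓘(ℝ, ℝ) 𝓘(ℝ, E) ∞ g t := fun t hts =>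
    contMDiffAt_of_smoothNear hg hts
  have hξ : ∀ t ∈ Icc t₀ t₁, ContDiffAt ℝ ∞ (reducedCurve E S g) t := fun t hts =>
    contDiffAt_reducedCurve_of_contMDiffAt S (hg' t hts)
  have hl := contDiff_reducedLagrangian hk hL hinv
  -- Euler–Lagrange is a condition in charts, so the comparison is made on short intervals along
  -- which `g` stays in one chart.
  have hloc : ∀ t ∈ Ioo t₀ t₁, ∀ e ∈ smoothCharts E G, g t ∈ e.source →
      ∃ a b : ℝ, t ∈ Ioo a b ∧ Icc a b ⊆ Icc t₀ t₁ ∧ ∀ s ∈ Icc a b, g s ∈ e.source := by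
    intro t hts e _ hs
    obtain ⟨a, b, hab, h⟩ := exists_Icc_subset_of_mem_nhds (inter_mem (Icc_mem_nhds hts.1 hts.2)
      ((hg' t (Ioo_subset_Icc_self hts)).continuousAt.preimage_mem_nhds (e.open_source.mem_nhds hs)))
    exact ⟨a, b, hab, fun s hs => (h hs).1, fun s hs => (h hs).2⟩
  have hEL : ∀ e ∈ smoothCharts E G, ∀ t ∈ Icc t₀ t₁, g t ∈ e.source →
      ContDiffAt ℝ ∞ (eulerOperator (localLagrangian L e) fun s => e (g s)) t := fun e he t hts hs =>
    contDiffAt_eulerOperator (contDiffAt_chart_comp (n := ⊤) he (hg' t hts) hs)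
      (contDiffAt_localLagrangian hL he (by simpa [derivTuple] using e.map_source hs))
  constructor
  · intro h
    refine eulerPoincare_of_Ioo S hl ht hξ fun t hts => ?_
    have he := chartAt_mem_smoothCharts (E := E) (g t)
    obtain ⟨a, b, hab, hsub, hsrc⟩ := hloc t hts _ he (mem_chart_source E (g t))
    have hle : a ≤ b := (hab.1.trans hab.2).le
    refine eulerPoincareOperator_eq_zero_of_integral S hl hle (fun s hs => hξ s (hsub hs))
      (fun η hη hsupp => ?_) t hab
    have hγ : ∀ s ∈ Icc a b, ContMDiffAt 𝓘(ℝ, ℝ × ℝ) 𝓘(ℝ, E) ∞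
        (fun p : ℝ × ℝ => groupVariation S g η p.1 p.2) (0, s) := fun s hs =>
      contMDiffAt_groupVariation S hη (hg' s (hsub hs)) (by
        simpa using unitPoint_mem_target (E := E) (G := G))
    have hvan : ∀ τ, τ ∉ Ioo a b → ∀ j < k, iteratedDeriv j
        (fun s => deriv (fun ε => chartAt E (g t) (groupVariation S g η ε s)) 0) τ = 0 := by
      intro τ hτ j _
      have h1 : η =ᶠ[𝓝 τ] fun _ => 0 := notMem_tsupport_iff_eventuallyEq.1 fun h => hτ (hsupp h)
      have h2 : (fun s => deriv (fun ε => chartAt E (g t) (groupVariation S g η ε s)) 0)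
          =ᶠ[𝓝 τ] fun _ => 0 := by
        filter_upwards [h1] with s hs
        simp only [groupVariation_of_eq_zero S g hs, deriv_const]
      rw [h2.iteratedDeriv_eq, iteratedDeriv_fun_const_zero]
    have k1 := hasDerivAt_action_chart hL he hle hγ (fun s hs => hg' s (hsub hs))
      (fun s _ => groupVariation_zero S g η s) hsrc (hvan a (by simp)) (hvan b (by simp))
    have k2 := hasDerivAt_invariantAction hk hL hinv hle hγ (fun s hs => hg' s (hsub hs))
      (fun s _ => groupVariation_zero S g η s)
      (fun j _ => by
        simp only [reducedCurve_groupVariation]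
        exact iteratedDeriv_eq_zero_of_notMem_tsupport hsupp (by simp) j)
      (fun j _ => by
        simp only [reducedCurve_groupVariation]
        exact iteratedDeriv_eq_zero_of_notMem_tsupport hsupp (by simp) j)
    simp only [reducedCurve_groupVariation] at k2
    -- `k1` and `k2` compute the derivative of the same action on the short interval; the
    -- Euler–Lagrange equations make the first value 0, so the second is 0 too.
    rw [integral_apply_eq_zero hle (F := eulerOperator (localLagrangian L (chartAt E (g t)))
      fun s => chartAt E (g t) (g s)) fun s hs => h s (hsub (Ioo_subset_Icc_self hs)) _ he
        (hsrc s (Ioo_subset_Icc_self hs))] at k1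
    exact neg_eq_zero.1 (k2.unique k1)
  · intro h
    have hint : ∀ t ∈ Ioo t₀ t₁, ∀ e ∈ smoothCharts E G, g t ∈ e.source →
        eulerOperator (localLagrangian L e) (fun s => e (g s)) t = 0 := by
      intro t hts e he hs
      obtain ⟨a, b, hab, hsub, hsrc⟩ := hloc t hts e he hs
      have hle : a ≤ b := (hab.1.trans hab.2).le
      refine ContinuousLinearMap.ext fun v => ?_
      refine eq_zero_of_integral_apply_eq_zero (μ := fun t v =>
        eulerOperator (localLagrangian L e) (fun s => e (g s)) t v) hle
        (fun v s hs => ((hEL e he s (hsub (Ioo_subset_Icc_self hs)) (hsrc s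
          (Ioo_subset_Icc_self hs))).clm_apply
            contDiffAt_const).continuousAt.continuousWithinAt)
        (fun s c v => by rw [map_smul, smul_eq_mul]) (fun w hw hsupp => ?_) t hab v
      -- Here the test variation is a straight line in the chart, so that δq is an arbitrary bump
      -- `w`.
      have hγ : ∀ s ∈ Icc a b, ContMDiffAt 𝓘(ℝ, ℝ × ℝ) 𝓘(ℝ, E) ∞
          (fun p : ℝ × ℝ => e.symm (e (g p.2) + p.1 • w p.2)) (0, s) := by
        intro s hs
        have c1 : ContDiffAt ℝ ∞ (fun p : ℝ × ℝ => e (g p.2)) (0, s) :=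
          ContDiffAt.fun_comp (f := fun p : ℝ × ℝ => p.2) (0, s)
            (contDiffAt_chart_comp (n := ⊤) he (hg' s (hsub hs)) (hsrc s hs)) contDiffAt_snd
        refine contMDiffAt_chart_symm_comp (n := ⊤) he (c1.add (contDiffAt_fst.smul
          (ContDiffAt.fun_comp (0, s) hw.contDiffAt contDiffAt_snd))) ?_
        simpa using e.map_source (hsrc s hs)
      have hγ0 : ∀ s ∈ Icc a b, e.symm (e (g s) + (0 : ℝ) • w s) = g s := fun s hs => by
        rw [zero_smul, add_zero, e.left_inv (hsrc s hs)]
      have hδ : ∀ s ∈ Icc a b, deriv (fun ε : ℝ => e (e.symm (e (g s) + ε • w s))) 0 = w s := by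
        intro s hs
        have h2 : HasDerivAt (fun ε : ℝ => e (g s) + ε • w s) (w s) 0 := by
          simpa using ((hasDerivAt_id (0 : ℝ)).smul_const (w s)).const_add (e (g s))
        refine (h2.congr_of_eventuallyEq ?_).deriv
        filter_upwards [h2.continuousAt.preimage_mem_nhds (e.open_target.mem_nhds (by
          simpa using e.map_source (hsrc s hs)))] with ε hε
        exact e.right_inv hε
      -- Beyond the interval `g s` may leave the chart, so the comparison is with `e.symm (e (g
      -- s))`; independence of ε is all that is needed.
      have hconst : ∀ τ, τ ∉ Ioo a b → ∀ᶠ s in 𝓝 τ, ∀ ε : ℝ,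
          e.symm (e (g s) + ε • w s) = e.symm (e (g s)) := by
        intro τ hτ
        have h1 : w =ᶠ[𝓝 τ] fun _ => 0 := notMem_tsupport_iff_eventuallyEq.1 fun h => hτ (hsupp h)
        filter_upwards [h1] with s hs ε
        rw [hs, smul_zero, add_zero]
      have hvan : ∀ τ, τ ∉ Ioo a b → ∀ j < k, iteratedDeriv j
          (fun s => deriv (fun ε : ℝ => e (e.symm (e (g s) + ε • w s))) 0) τ = 0 := by
        intro τ hτ j _
        have h2 : (fun s => deriv (fun ε : ℝ => e (e.symm (e (g s) + ε • w s))) 0)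
            =ᶠ[𝓝 τ] fun _ => 0 := by
          filter_upwards [hconst τ hτ] with s hs
          simp only [hs, deriv_const]
        rw [h2.iteratedDeriv_eq, iteratedDeriv_fun_const_zero]
      have hvan' : ∀ τ, τ ∉ Ioo a b → ∀ j < k, iteratedDeriv j
          (fun s => reducedCurve E S (fun ε : ℝ => e.symm (e (g s) + ε • w s)) 0) τ = 0 := by
        intro τ hτ j _
        have h2 : (fun s => reducedCurve E S (fun ε : ℝ => e.symm (e (g s) + ε • w s)) 0)
            =ᶠ[𝓝 τ] fun _ => 0 := by
          filter_upwards [hconst τ hτ] with s hs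
          simp only [hs, reducedCurve_const]
        rw [h2.iteratedDeriv_eq, iteratedDeriv_fun_const_zero]
      have k1 := hasDerivAt_action_chart hL he hle (γ := fun ε s => e.symm (e (g s) + ε • w s)) hγ
        (fun s hs => hg' s (hsub hs)) hγ0 hsrc (hvan a (by simp)) (hvan b (by simp))
      have k2 := hasDerivAt_invariantAction hk hL hinv hle
        (γ := fun ε s => e.symm (e (g s) + ε • w s)) hγ (fun s hs => hg' s (hsub hs)) hγ0
        (hvan' a (by simp)) (hvan' b (by simp))
      rw [integral_apply_eq_zero hle (F := eulerPoincareOperator G S (reducedLagrangian S L)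
        (reducedCurve E S g)) fun s hs => h s (hsub (Ioo_subset_Icc_self hs)), neg_zero] at k2
      refine Eq.trans (intervalIntegral_congr_Ioo hle fun s hs => ?_) (k1.unique k2)
      rw [hδ s (Ioo_subset_Icc_self hs)]
    intro t hts e he hs
    refine eq_zero_of_continuousAt_of_Ioo ht hts (hEL e he t hts hs).continuousAt ?_
    filter_upwards [(hg' t hts).continuousAt.preimage_mem_nhds (e.open_source.mem_nhds hs)]
      with s hs hst using hint s hst e he hs

end Hamilton

end HigherOrderEP

end

/-! ### The equivalences, all routed through the Euler–Poincaré equations. -/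

theorem theorem3p1
    {E : Type*} [NormedAddCommGroup E] [NormedSpace ℝ E] [FiniteDimensional ℝ E]
    {G : Type*} [TopologicalSpace G] [ChartedSpace E G] [Group G] [LieGroup 𝓘(ℝ, E) ∞ G]
    (S : HigherOrderEP.Side) (k : ℕ) (hk : 1 ≤ k)
    (L : HigherOrderEP.HigherTangent E k G → ℝ)
    (hL : HigherOrderEP.IsSmoothLagrangian L)
    (hinv : HigherOrderEP.IsInvariantLagrangian S L)
    (t₀ t₁ : ℝ) (ht : t₀ < t₁)
    (g : ℝ → G) (hg : HigherOrderEP.SmoothNear (E := E) g (Icc t₀ t₁)) :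
    List.TFAE [
      HigherOrderEP.EulerLagrange L g t₀ t₁,
      HigherOrderEP.HamiltonPrinciple L g t₀ t₁,
      HigherOrderEP.EulerPoincare G S (HigherOrderEP.reducedLagrangian S L)
        (HigherOrderEP.reducedCurve E S g) t₀ t₁,
      HigherOrderEP.ReducedPrinciple G S (HigherOrderEP.reducedLagrangian S L)
        (HigherOrderEP.reducedCurve E S g) t₀ t₁] := by
  have h13 := HigherOrderEP.eulerLagrange_iff_eulerPoincare hk hL hinv ht hg
  have h23 := HigherOrderEP.hamiltonPrinciple_iff_eulerPoincare hk hL hinv ht hg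
  have h43 := HigherOrderEP.reducedPrinciple_iff_eulerPoincare (G := G) S hk
    (HigherOrderEP.contDiff_reducedLagrangian hk hL hinv) ht
    (HigherOrderEP.smoothNear_reducedCurve S hg)
  tfae_have 1 ↔ 3 := h13
  tfae_have 2 ↔ 3 := h23
  tfae_have 4 ↔ 3 := h43
  tfae_finish
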